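/- Let $q$ be a complex number with $0<|q|<1$. Put $(x;q)_\infty=\prod_{n\ge 0}(1-xq^n)$, $(x;q)_n=(x;q)_\infty/(xq^n;q)_\infty$ for $n\in\mathbb Z$ (that is, $\prod_{j=0}^{n-1}(1-xq^j)$ for $n\ge 0$ and $\prod_{j=1}^{-n}(1-xq^{-j})^{-1}$ for $n<0$), $(x_1,\dots,x_m;q)_n=\prod_i (x_i;q)_n$ (also for $n=\infty$), $$\theta(x)=\frac1{(q;q)_\infty}\sum_{n=-\infty}^\infty(-1)^nq^{n(n-1)/2}x^n\quad(x\ne 0),\qquad \theta(x_1,\dots,x_m)=\prod_i\theta(x_i),$$ $$\Omega(x_1,\dots,x_n;a_1,\dots,a_m)=\prod_{i=1}^n\prod_{j=1}^m (x_i/a_j;q)_\infty .$$ For $A\ne0$ the very-well-poised series are $${}_8W_7[A;p_1,\dots,p_5;q,w]=\sum_{n=0}^\infty\frac{(A,q\sqrt A,-q\sqrt A,p_1,\dots,p_5;q)_n}{(q,\sqrt A,-\sqrt A,Aq/p_1,\dots,Aq/p_5;q)_n}\,w^n,$$ $${}_8\psi_8[A;p_1,\dots,p_6;q,w]=\sum_{n=-\infty}^\infty\frac{(q\sqrt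 A,-q\sqrt A,p_1,\dots,p_6;q)_n}{(\sqrt A,-\sqrt A,Aq/p_1,\dots,Aq/p_6;q)_n}\,w^n.$$ Let $a,b,c,d,e,h,k,z$ be nonzero complex numbers such that $$\Big|\frac{a^3q^2}{bcdehk}\Big|<1 ,$$ and such that no denominator in the formulas below vanishes; explicitly: none of $a,\ z,\ z/a,\ z^2/a$ is an integer power of $q$; $\frac{b^2}{a}q^{2n}\ne1$ for all integers $n\ge 0$; $\Omega(q,aq,aq/z,zq;b,c,d,e,h,k)\ne0$; and $\Omega(aq/b,bq;c,d,e,h,k)\neq0$. Then the three series below converge absolutely and $$\begin{aligned} {}_8W_7\Big[\frac{b^2}{a};\frac{bc}{a},\frac{bd}{a},\frac{be}{a},\frac{bh}{a},\frac{bk}{a};q,\frac{a^3q^2}{bcdehk}\Big] &=\lambda_1\;{}_8\psi_8\Big[a;b,c,d,e,h,k;q,\frac{a^3q^2}{bcdehk}\Big]\\ &\quad+\mu_1\;{}_8\psi_8\Big[\frac{z^2}{a};\frac{bz}{a},\frac{cz}{a},\frac{dz}{a},\frac{ez}{a},\frac{hz}{a},\frac{kz}{a};q,\frac{a^3q^2}{bcdehk}\Big],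 \end{aligned}$$ where $$\lambda_1=\frac{(b^2q/a;q)_\infty}{(q,aq,q/a;q)_\infty}\,\frac{\Omega(q,aq;b,c,d,e,h,k)}{\Omega(aq/b,bq;c,d,e,h,k)}\,\frac{\theta(bz/a,z/b)}{\theta(z/a,z)},$$ $$\mu_1=\frac{(b^2q/a;q)_\infty}{(q,z^2q/a,aq/z^2;q)_\infty}\,\frac{\Omega(aq/z,zq;b,c,d,e,h,k)}{\Omega(aq/b,bq;c,d,e,h,k)}\,\frac{\theta(a/b,b)}{\theta(a/z,z)}.$$ -/

import Mathlib

namespace QSeries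

noncomputable section

/-- The infinite `q`-shifted factorial `(x;q)_∞ = ∏_{n ≥ 0} (1 - x q^n)`. -/
def qInf (q x : ℂ) : ℂ := ∏' n : ℕ, (1 - x * q ^ n)

/-- The multi-parameter symbol `(x₁, …, x_m; q)_∞`. -/
def qInfL (q : ℂ) (xs : List ℂ) : ℂ := (xs.map (qInf q)).prod

/-- The `q`-shifted factorial `(x;q)_n` for an integer `n`:
`(1 - x)(1 - xq)⋯(1 - xq^{n-1})` for `n ≥ 0`, and
`1 / ((1 - xq⁻¹)(1 - xq⁻²)⋯(1 - xq^{n}))` for `n < 0`.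
It is the quotient `(x;q)_∞ / (q^n x;q)_∞`, see `qPoch_eq_div`, with the usual finite-product
meaning where that quotient would read `0 / 0`. -/
def qPoch (q x : ℂ) : ℤ → ℂ
  | Int.ofNat n => ∏ j ∈ Finset.range n, (1 - x * q ^ j)
  | Int.negSucc n => (∏ j ∈ Finset.range (n + 1), (1 - x * (q ^ (j + 1))⁻¹))⁻¹

/-- The multi-parameter symbol `(x₁, …, x_m; q)_n`. -/
def qPochL (q : ℂ) (xs : List ℂ) (n : ℤ) : ℂ := (xs.map fun x => qPoch q x n).prod

/-- The Jacobi theta function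
`θ(x) = (q;q)_∞⁻¹ ∑_{n ∈ ℤ} (-1)^n q^{n(n-1)/2} x^n` (for `x ≠ 0`). -/
def theta (q x : ℂ) : ℂ :=
  (qInf q q)⁻¹ * ∑' n : ℤ, (-1 : ℂ) ^ n * q ^ (n * (n - 1) / 2) * x ^ n

/-- The multi-parameter symbol `θ(x₁, …, x_m)`. -/
def thetaL (q : ℂ) (xs : List ℂ) : ℂ := (xs.map (theta q)).prod

/-- `Ω(x₁, …, x_n; a₁, …, a_m) = ∏_i ∏_j (x_i / a_j; q)_∞`. -/
def Omega (q : ℂ) (xs as : List ℂ) : ℂ :=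
  (xs.map fun x => (as.map fun a => qInf q (x / a)).prod).prod

/-- The `n`-th term of the unilateral series `ᵣ₊₁φᵣ[as; bs; q, w]`. -/
def phiTerm (q : ℂ) (as bs : List ℂ) (w : ℂ) (n : ℕ) : ℂ :=
  qPochL q as n / qPochL q bs n * (w ^ n / qPoch q q n)

/-- The `n`-th term of the bilateral series `ᵣψᵣ[as; bs; q, w]`. -/
def psiTerm (q : ℂ) (as bs : List ℂ) (w : ℂ) (n : ℤ) : ℂ :=
  qPochL q as n / qPochL q bs n * w ^ n

/-- The parameters `q√a, -q√a, p₁, p₂, …` of a very-well-poised series. The two choices of the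
square root give the same list up to order. -/
def vwpUpper (q a : ℂ) (ps : List ℂ) : List ℂ :=
  q * a ^ (1 / 2 : ℂ) :: -(q * a ^ (1 / 2 : ℂ)) :: ps

/-- The matching lower parameters `aq / α`, for `α` in `vwpUpper q a ps`. -/
def vwpLower (q a : ℂ) (ps : List ℂ) : List ℂ :=
  (vwpUpper q a ps).map fun α => a * q / α

/-- The `n`-th term of the very-well-poised series `ᵣ₊₁Wᵣ[a; ps; q, w]`
(of type `₈W₇` when `ps` has five entries). -/
def WTerm (q a : ℂ) (ps : List ℂ) (w : ℂ) : ℕ → ℂ :=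
  phiTerm q (a :: vwpUpper q a ps) (vwpLower q a ps) w

/-- The very-well-poised series `ᵣ₊₁Wᵣ[a; ps; q, w]`. -/
def W (q a : ℂ) (ps : List ℂ) (w : ℂ) : ℂ := ∑' n : ℕ, WTerm q a ps w n

/-- The `n`-th term of the very-well-poised bilateral series `ᵣψᵣ[a; ps; q, w]`
(of type `₈ψ₈` when `ps` has six entries). -/
def vwpPsiTerm (q a : ℂ) (ps : List ℂ) (w : ℂ) : ℤ → ℂ :=
  psiTerm q (vwpUpper q a ps) (vwpLower q a ps) w

/-- The very-well-poised bilateral series `ᵣψᵣ[a; ps; q, w]`. -/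
def vwpPsi (q a : ℂ) (ps : List ℂ) (w : ℂ) : ℂ := ∑' n : ℤ, vwpPsiTerm q a ps w n

/-- The coefficient `λ₁`. -/
def lambda₁ (q a b c d e h k z : ℂ) : ℂ :=
  qInf q (b ^ 2 * q / a) / qInfL q [q, a * q, q / a]
    * (Omega q [q, a * q] [b, c, d, e, h, k] / Omega q [a * q / b, b * q] [c, d, e, h, k])
    * (thetaL q [b * z / a, z / b] / thetaL q [z / a, z])

/-- The coefficient `μ₁`. -/
def mu₁ (q a b c d e h k z : ℂ) : ℂ :=
  qInf q (b ^ 2 * q / a) / qInfL q [q, z ^ 2 * q / a, a * q / z ^ 2]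
    * (Omega q [a * q / z, z * q] [b, c, d, e, h, k]
        / Omega q [a * q / b, b * q] [c, d, e, h, k])
    * (thetaL q [a / b, b] / thetaL q [a / z, z])

theorem multipliable_qInf {q : ℂ} (hq : ‖q‖ < 1) (x : ℂ) :
    Multipliable fun n : ℕ => 1 - x * q ^ n := by
  have h : Summable fun n : ℕ => ‖-(x * q ^ n)‖ := by
    simpa [norm_mul, norm_pow] using
      (summable_geometric_of_lt_one (norm_nonneg q) hq).mul_left ‖x‖
  simpa [sub_eq_add_neg] using multipliable_one_add_of_summable h

/-- `(x;q)_{n} (q^n x;q)_∞ = (x;q)_∞` for natural `n`. -/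
theorem prod_mul_qInf {q : ℂ} (hq : ‖q‖ < 1) (x : ℂ) (n : ℕ) :
    (∏ j ∈ Finset.range n, (1 - x * q ^ j)) * qInf q (q ^ n * x) = qInf q x := by
  have e : (fun j : ℕ => 1 - q ^ n * x * q ^ j) = fun j => 1 - x * q ^ (j + n) := by
    funext j; ring
  have h := multipliable_qInf hq (q ^ n * x)
  rw [e] at h
  unfold qInf
  rw [e]
  exact Multipliable.prod_mul_tprod_nat_mul' (f := fun j : ℕ => 1 - x * q ^ j) h

/-- The quotient form of the `q`-shifted factorial. -/
theorem qPoch_eq_div {q : ℂ} (hq0 : q ≠ 0) (hq : ‖q‖ < 1) (x : ℂ) (n : ℤ)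
    (hx : qInf q x ≠ 0) (hn : qInf q (q ^ n * x) ≠ 0) :
    qPoch q x n = qInf q x / qInf q (q ^ n * x) := by
  cases n with
  | ofNat n =>
    rw [eq_div_iff hn]
    simpa [qPoch] using prod_mul_qInf hq x n
  | negSucc n =>
    have h := prod_mul_qInf hq (q ^ (Int.negSucc n) * x) (n + 1)
    have e1 : q ^ (n + 1) * (q ^ (Int.negSucc n) * x) = x := by
      rw [zpow_negSucc]; field_simp
    rw [e1, ← Finset.prod_range_reflect] at h
    have e2 : ∀ j ∈ Finset.range (n + 1),
        1 - q ^ (Int.negSucc n) * x * q ^ (n + 1 - 1 - j) = 1 - x * (q ^ (j + 1))⁻¹ := by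
      intro j hj
      have hj' : j ≤ n := by simpa [Nat.lt_succ_iff] using hj
      obtain ⟨m, rfl⟩ := Nat.exists_eq_add_of_le hj'
      have : j + m + 1 - 1 - j = m := by omega
      rw [this, zpow_negSucc]
      field_simp
      ring
    rw [Finset.prod_congr rfl e2] at h
    simp only [qPoch]
    rw [← h]
    have : (∏ j ∈ Finset.range (n + 1), (1 - x * (q ^ (j + 1))⁻¹)) ≠ 0 := by
      intro h0; rw [h0, zero_mul] at h; exact hn h.symm
    field_simp

end

end QSeries

/-!
Write `p = (b, c, d, e, h, k)` and `Ω(x) = ∏ᵢ (x / pᵢ; q)_∞`. Up to elementary factors, the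
bilateral series with base `x² / a` and parameters `pᵢ x / a` is an average over the orbit `x q^ℤ`
of the kernel `(x⁻¹ - x / a) Ω(xq) Ω(aq / x)`. As a function of `x ≠ 0` this average `E` is analytic
and satisfies `(q x² / a)³ E(qx) = E(x)` and `E(a / x) = -E(x)`. The second relation makes it vanish
at the zeros of `θ(x² / a)`; if `E` also vanishes at `y`, the first one forces it to be a constant
multiple of `x⁻¹ θ(x² / a) θ(xy / a) θ(y / x)`. Such functions therefore form a two-dimensional
space, in which `E(b)` is determined by `E(a)` and `E(z)`. At `x = b` the factor `Ω(xq)` kills all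
terms of negative index, so `E(b)` gives the `₈W₇` series, while `E(a)` and `E(z)` give the two
`₈ψ₈` series. If `θ(b² / a) = 0` then `E(b) = 0` carries no information, and the relation follows by
continuity in `b`.
-/

namespace QSeries

open Filter Topology

noncomputable section

section Division

theorem analyticOrderAt_le_of_le_one {E T : ℂ → ℂ} {x : ℂ} (hE : AnalyticAt ℂ E x)
    (hT : analyticOrderAt T x ≤ 1) (h : T x = 0 → E x = 0) :
    analyticOrderAt T x ≤ analyticOrderAt E x := by
  by_cases h0 : analyticOrderAt T x = 0
  · simp [h0]
  · exact hT.trans (Order.one_le_iff_ne_zero.2 (analyticOrderAt_ne_zero.2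
      ⟨hE, h (apply_eq_zero_of_analyticOrderAt_ne_zero h0)⟩))

theorem analyticOrderAt_mul_le_one {f g : ℂ → ℂ} {x : ℂ} (hf : AnalyticAt ℂ f x)
    (hg : AnalyticAt ℂ g x) (hf1 : analyticOrderAt f x ≤ 1) (hg1 : analyticOrderAt g x ≤ 1)
    (h : f x ≠ 0 ∨ g x ≠ 0) : analyticOrderAt (f * g) x ≤ 1 := by
  rw [analyticOrderAt_mul hf hg]
  rcases h with h | h
  · rwa [hf.analyticOrderAt_eq_zero.2 h, zero_add]
  · rwa [hg.analyticOrderAt_eq_zero.2 h, add_zero]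

theorem eventually_ne_zero_of_analyticOrderAt_ne_top {f : ℂ → ℂ} {x : ℂ} (hf : AnalyticAt ℂ f x)
    (h : analyticOrderAt f x ≠ ⊤) : ∀ᶠ y in 𝓝[≠] x, f y ≠ 0 :=
  hf.eventually_eq_zero_or_eventually_ne_zero.resolve_left (mt analyticOrderAt_eq_top.2 h)

theorem exists_eq_mul_of_analyticOrderAt_le {U : Set ℂ} {E T : ℂ → ℂ}
    (hE : AnalyticOnNhd ℂ E U) (hT : AnalyticOnNhd ℂ T U)
    (htop : ∀ x ∈ U, analyticOrderAt T x ≠ ⊤)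
    (hle : ∀ x ∈ U, analyticOrderAt T x ≤ analyticOrderAt E x) :
    ∃ Q : ℂ → ℂ, AnalyticOnNhd ℂ Q U ∧ ∀ x ∈ U, E x = T x * Q x := by
  have hmer : MeromorphicOn (E / T) U := fun x hx =>
    (hE x hx).meromorphicAt.div (hT x hx).meromorphicAt
  have heq (x) (hx : x ∈ U) : toMeromorphicNFOn (E / T) U =ᶠ[𝓝[≠] x] E / T :=
    hmer.toMeromorphicNFOn_eq_self_on_nhdsNE hx
  have hQ : AnalyticOnNhd ℂ (toMeromorphicNFOn (E / T) U) U := fun x hx => by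
    refine (meromorphicNFOn_toMeromorphicNFOn _ _ hx).meromorphicOrderAt_nonneg_iff_analyticAt.1 ?_
    rw [meromorphicOrderAt_congr (heq x hx),
      meromorphicOrderAt_div (hE x hx).meromorphicAt (hT x hx).meromorphicAt,
      (hE x hx).meromorphicOrderAt_eq, (hT x hx).meromorphicOrderAt_eq]
    obtain ⟨n, hn⟩ := ENat.ne_top_iff_exists.1 (htop x hx)
    have hnle := hle x hx
    rw [← hn] at hnle ⊢
    cases hm : analyticOrderAt E x with
    | top => exact le_top
    | coe m =>
      rw [hm, Nat.cast_le] at hnle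
      exact WithTop.coe_le_coe.2 (sub_nonneg.2 (Int.ofNat_le.2 hnle))
  refine ⟨_, hQ, fun x hx => ?_⟩
  have hne := eventually_ne_zero_of_analyticOrderAt_ne_top (hT x hx) (htop x hx)
  have hpunctured : E =ᶠ[𝓝[≠] x] T * toMeromorphicNFOn (E / T) U := by
    filter_upwards [heq x hx, hne] with y hy hTy
    rw [Pi.mul_apply, hy, Pi.div_apply, mul_div_cancel₀ _ hTy]
  exact (((hE x hx).continuousAt.eventuallyEq_nhds_iff_eventuallyEq_nhdsNE
    ((hT x hx).mul (hQ x hx)).continuousAt).1 hpunctured).eq_of_nhds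

end Division

section Periodicity

variable {q : ℂ}

theorem exists_norm_zpow_mul_mem_Icc (hq0 : q ≠ 0) (hq : ‖q‖ < 1) {x : ℂ} (hx : x ≠ 0) :
    ∃ m : ℤ, ‖q ^ m * x‖ ∈ Set.Icc 1 ‖q‖⁻¹ := by
  have hq' : 0 < ‖q‖ := norm_pos_iff.2 hq0
  obtain ⟨m, hm1, hm2⟩ := exists_mem_Ico_zpow (norm_pos_iff.2 hx) ((one_lt_inv₀ hq').2 hq)
  have hpos := zpow_pos hq' m
  refine ⟨m, ?_⟩
  rw [Set.mem_Icc, norm_mul, norm_zpow]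
  rw [inv_zpow, inv_le_iff_one_le_mul₀' hpos] at hm1
  rw [zpow_add_one₀ (inv_ne_zero hq'.ne'), inv_zpow, ← div_eq_inv_mul, lt_div_iff₀' hpos] at hm2
  exact ⟨hm1, hm2.le⟩

theorem apply_zpow_mul_of_periodic {α : Type*} (hq0 : q ≠ 0) {f : ℂ → α}
    (hper : ∀ x ≠ 0, f (q * x) = f x) (m : ℤ) {x : ℂ} (hx : x ≠ 0) : f (q ^ m * x) = f x := by
  have hstep : Function.Periodic (fun n : ℤ => f (q ^ n * x)) 1 := fun n => by
    simp only [zpow_add_one₀ hq0, mul_comm _ q, mul_assoc]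
    exact hper _ (mul_ne_zero (zpow_ne_zero n hq0) hx)
  simpa using hstep.int_mul_eq m

/- Precomposing with `exp` gives a bounded entire function. -/
theorem apply_eq_apply_of_q_periodic (hq0 : q ≠ 0) (hq : ‖q‖ < 1) {f : ℂ → ℂ}
    (hf : AnalyticOnNhd ℂ f {0}ᶜ) (hper : ∀ x ≠ 0, f (q * x) = f x) {x y : ℂ}
    (hx : x ≠ 0) (hy : y ≠ 0) : f x = f y := by
  have hK : IsCompact {x : ℂ | ‖x‖ ∈ Set.Icc 1 ‖q‖⁻¹} := by
    refine Metric.isCompact_of_isClosed_isBounded (isClosed_Icc.preimage continuous_norm) ?_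
    exact isBounded_iff_forall_norm_le.2 ⟨‖q‖⁻¹, fun x hx => hx.2⟩
  obtain ⟨C, hC⟩ := hK.exists_bound_of_continuousOn (hf.continuousOn.mono (by
    rintro x ⟨hx, -⟩ rfl
    norm_num at hx))
  have hentire : Differentiable ℂ fun w => f (Complex.exp w) := fun w =>
    (hf _ (Complex.exp_ne_zero w)).differentiableAt.comp w Complex.differentiableAt_exp
  have hbdd : Bornology.IsBounded (Set.range fun w => f (Complex.exp w)) := by
    refine isBounded_iff_forall_norm_le.2 ⟨C, ?_⟩
    rintro _ ⟨w, rfl⟩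
    obtain ⟨m, hm⟩ := exists_norm_zpow_mul_mem_Icc hq0 hq (Complex.exp_ne_zero w)
    simpa only [apply_zpow_mul_of_periodic hq0 hper m (Complex.exp_ne_zero w)] using hC _ hm
  simpa only [Complex.exp_log hx, Complex.exp_log hy] using
    hentire.apply_eq_apply_of_bounded hbdd (Complex.log x) (Complex.log y)

theorem exists_eq_const_mul_of_q_multiplier (hq0 : q ≠ 0) (hq : ‖q‖ < 1)
    {E T m : ℂ → ℂ} (hE : AnalyticOnNhd ℂ E {0}ᶜ) (hT : AnalyticOnNhd ℂ T {0}ᶜ)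
    (htop : ∀ x ≠ 0, analyticOrderAt T x ≠ ⊤)
    (hle : ∀ x ≠ 0, analyticOrderAt T x ≤ analyticOrderAt E x)
    (hEm : ∀ x ≠ 0, m x * E (q * x) = E x) (hTm : ∀ x ≠ 0, m x * T (q * x) = T x) :
    ∃ K : ℂ, ∀ x ≠ 0, E x = K * T x := by
  obtain ⟨Q, hQ, hEQ⟩ := exists_eq_mul_of_analyticOrderAt_le hE hT htop hle
  have hper : ∀ x ≠ 0, Q (q * x) = Q x := fun x hx => by
    have hQq : ContinuousAt (fun y => Q (q * y)) x :=
      (hQ _ (mul_ne_zero hq0 hx)).continuousAt.comp (f := fun y => q * y) (by fun_prop)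
    refine ((hQq.eventuallyEq_nhds_iff_eventuallyEq_nhdsNE (hQ x hx).continuousAt).1 ?_).eq_of_nhds
    filter_upwards [eventually_ne_zero_of_analyticOrderAt_ne_top (hT x hx) (htop x hx),
      nhdsWithin_le_nhds (isOpen_ne.mem_nhds hx)] with y hTy hy
    have h := hEm y hy
    rw [hEQ y hy, hEQ _ (mul_ne_zero hq0 hy), ← mul_assoc, hTm y hy] at h
    exact mul_left_cancel₀ hTy h
  refine ⟨Q 1, fun x hx => ?_⟩
  rw [hEQ x hx, apply_eq_apply_of_q_periodic hq0 hq hQ hper hx one_ne_zero, mul_comm]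

end Periodicity

section ShiftedFactorial

variable {q : ℂ}

theorem qInf_eq_one_sub_mul (hq : ‖q‖ < 1) (x : ℂ) : qInf q x = (1 - x) * qInf q (q * x) := by
  simpa using (prod_mul_qInf hq x 1).symm

theorem qInf_eq_zero_iff (hq : ‖q‖ < 1) {x : ℂ} : qInf q x = 0 ↔ ∃ n : ℕ, x * q ^ n = 1 := by
  constructor
  · contrapose!
    intro h
    have hsum : Summable fun n : ℕ => ‖-(x * q ^ n)‖ := by
      simpa [norm_mul, norm_pow] using
        (summable_geometric_of_lt_one (norm_nonneg q) hq).mul_left ‖x‖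
    simpa [qInf, sub_eq_add_neg] using
      tprod_one_add_ne_zero_of_summable (f := fun n : ℕ => -(x * q ^ n))
        (fun n h0 => h n (by linear_combination -h0)) hsum
  · rintro ⟨n, h⟩
    rw [← prod_mul_qInf hq x (n + 1), Finset.prod_eq_zero (Finset.self_mem_range_succ n),
      zero_mul]
    rw [h, sub_self]

theorem pow_succ_ne_one (hq : ‖q‖ < 1) (n : ℕ) : q ^ (n + 1) ≠ 1 := fun h =>
  (pow_lt_one₀ (norm_nonneg q) hq n.succ_ne_zero).ne (by rw [← norm_pow, h, norm_one])

theorem qInf_self_ne_zero (hq : ‖q‖ < 1) : qInf q q ≠ 0 := by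
  rw [Ne, qInf_eq_zero_iff hq]
  rintro ⟨n, h⟩
  exact pow_succ_ne_one hq n (by rw [pow_succ', h])

theorem norm_prod_one_sub_le (hq : ‖q‖ < 1) (x : ℂ) (n : ℕ) :
    ‖∏ j ∈ Finset.range n, (1 - x * q ^ j)‖ ≤ Real.exp (‖x‖ / (1 - ‖q‖)) := by
  rw [norm_prod]
  calc ∏ j ∈ Finset.range n, ‖1 - x * q ^ j‖
      ≤ ∏ j ∈ Finset.range n, Real.exp (‖x‖ * ‖q‖ ^ j) := by
        refine Finset.prod_le_prod (fun _ _ => norm_nonneg _) fun j _ => ?_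
        calc ‖1 - x * q ^ j‖ ≤ ‖(1 : ℂ)‖ + ‖x * q ^ j‖ := norm_sub_le _ _
          _ = ‖x‖ * ‖q‖ ^ j + 1 := by rw [norm_one, norm_mul, norm_pow, add_comm]
          _ ≤ Real.exp (‖x‖ * ‖q‖ ^ j) := Real.add_one_le_exp _
    _ = Real.exp (‖x‖ * ∑ j ∈ Finset.range n, ‖q‖ ^ j) := by
        rw [← Real.exp_sum, Finset.mul_sum]
    _ ≤ Real.exp (‖x‖ / (1 - ‖q‖)) := by
        rw [div_eq_mul_inv, ← tsum_geometric_of_lt_one (norm_nonneg q) hq]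
        gcongr
        exact (summable_geometric_of_lt_one (norm_nonneg q) hq).sum_le_tsum _
          (fun _ _ => by positivity)

theorem norm_qInf_le (hq : ‖q‖ < 1) (x : ℂ) : ‖qInf q x‖ ≤ Real.exp (‖x‖ / (1 - ‖q‖)) :=
  le_of_tendsto' (multipliable_qInf hq x).hasProd.tendsto_prod_nat.norm
    fun n => norm_prod_one_sub_le hq x n

theorem differentiable_qInf (hq : ‖q‖ < 1) : Differentiable ℂ (qInf q) := fun x => by
  have hx : Metric.ball (0 : ℂ) (‖x‖ + 1) ∈ 𝓝 x := Metric.isOpen_ball.mem_nhds (by simp)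
  have hprod : HasProdLocallyUniformlyOn (fun (n : ℕ) y => 1 + -(y * q ^ n))
      (fun y => ∏' n : ℕ, (1 + -(y * q ^ n))) (Metric.ball 0 (‖x‖ + 1)) := by
    refine ((summable_geometric_of_lt_one (norm_nonneg q) hq).mul_left
      (‖x‖ + 1)).hasProdLocallyUniformlyOn_nat_one_add Metric.isOpen_ball
      (Eventually.of_forall fun n y hy => ?_) (fun n => by fun_prop)
    rw [norm_neg, norm_mul, norm_pow]
    gcongr
    exact (mem_ball_zero_iff.1 hy).le
  have hqInf : qInf q = fun y => ∏' n : ℕ, (1 + -(y * q ^ n)) :=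
    funext fun y => by simp only [qInf, sub_eq_add_neg]
  rw [hqInf]
  exact (hprod.differentiableOn (Eventually.of_forall fun s => by fun_prop)
    Metric.isOpen_ball).differentiableAt hx

theorem analyticAt_qInf (hq : ‖q‖ < 1) (x : ℂ) : AnalyticAt ℂ (qInf q) x :=
  (differentiable_qInf hq).analyticAt x

theorem continuous_qInf (hq : ‖q‖ < 1) : Continuous (qInf q) := (differentiable_qInf hq).continuous

theorem analyticOrderAt_qInf_eq_add (hq0 : q ≠ 0) (hq : ‖q‖ < 1) (x : ℂ) :
    analyticOrderAt (qInf q) x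
      = analyticOrderAt (fun y => 1 - y) x + analyticOrderAt (qInf q) (q * x) := by
  have hmul : AnalyticAt ℂ (fun y => q * y) x := by fun_prop
  have hfactor : qInf q = (fun y => 1 - y) * (qInf q ∘ fun y => q * y) :=
    funext (qInf_eq_one_sub_mul hq)
  conv_lhs => rw [hfactor]
  rw [analyticOrderAt_mul (by fun_prop) ((analyticAt_qInf hq _).comp hmul),
    analyticOrderAt_comp_of_deriv_ne_zero hmul (by simpa [deriv_const_mul_field] using hq0)]

theorem analyticOrderAt_qInf_le_one (hq0 : q ≠ 0) (hq : ‖q‖ < 1) (x : ℂ) :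
    analyticOrderAt (qInf q) x ≤ 1 := by
  by_cases hx : qInf q x = 0
  swap
  · simp [analyticOrderAt_eq_zero.2 (Or.inr hx)]
  obtain ⟨n, hn⟩ := (qInf_eq_zero_iff hq).1 hx
  clear hx
  induction n generalizing x with
  | zero =>
    rw [pow_zero, mul_one] at hn
    have hone : analyticOrderAt (fun y : ℂ => 1 - y) 1 = 1 :=
      AnalyticAt.analyticOrderAt_eq_one_of_zero_deriv_ne_zero (by fun_prop) (sub_self 1) (by simp)
    rw [hn, analyticOrderAt_qInf_eq_add hq0 hq, hone, mul_one,
      analyticOrderAt_eq_zero.2 (Or.inr (qInf_self_ne_zero hq)), add_zero]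
  | succ n ih =>
    have hx1 : 1 - x ≠ 0 := fun h => pow_succ_ne_one hq n <| by
      rwa [← sub_eq_zero.1 h, one_mul] at hn
    rw [analyticOrderAt_qInf_eq_add hq0 hq,
      (analyticOrderAt_eq_zero (f := fun y => 1 - y)).2 (Or.inr hx1), zero_add]
    exact ih _ (by rw [← hn]; ring)

end ShiftedFactorial

section ThetaProduct

variable {q : ℂ}

/-- The product form `(y;q)_∞ (q/y;q)_∞` of the theta function. -/
def thetaProd (q y : ℂ) : ℂ := qInf q y * qInf q (q / y)

theorem thetaProd_q_div (hq0 : q ≠ 0) (y : ℂ) : thetaProd q (q / y) = thetaProd q y := by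
  rw [thetaProd, thetaProd, div_div_cancel₀ hq0, mul_comm]

theorem neg_mul_thetaProd_q_mul (hq0 : q ≠ 0) (hq : ‖q‖ < 1) {y : ℂ} (hy : y ≠ 0) :
    -y * thetaProd q (q * y) = thetaProd q y := by
  have e : q / (q * y) = y⁻¹ := by field_simp
  rw [thetaProd, thetaProd, e, qInf_eq_one_sub_mul hq y, qInf_eq_one_sub_mul hq y⁻¹, div_eq_mul_inv]
  field_simp
  ring

theorem neg_mul_thetaProd_inv (hq0 : q ≠ 0) (hq : ‖q‖ < 1) {y : ℂ} (hy : y ≠ 0) :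
    -y * thetaProd q y⁻¹ = thetaProd q y := by
  rw [← neg_mul_thetaProd_q_mul hq0 hq hy, ← thetaProd_q_div hq0 (q * y), div_mul_cancel_left₀ hq0]

theorem thetaProd_one (hq : ‖q‖ < 1) : thetaProd q 1 = 0 := by
  rw [thetaProd, (qInf_eq_zero_iff hq).2 ⟨0, by simp⟩, zero_mul]

theorem exists_eq_zpow_of_thetaProd_eq_zero (hq0 : q ≠ 0) (hq : ‖q‖ < 1) {y : ℂ} (hy : y ≠ 0)
    (h : thetaProd q y = 0) : ∃ m : ℤ, y = q ^ m := by
  rcases mul_eq_zero.1 h with h | h <;> obtain ⟨n, hn⟩ := (qInf_eq_zero_iff hq).1 h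
  · exact ⟨-n, by rw [zpow_neg, zpow_natCast]; exact eq_inv_of_mul_eq_one_left hn⟩
  · refine ⟨n + 1, ?_⟩
    rw [zpow_add_one₀ hq0, zpow_natCast]
    field_simp at hn
    rw [← hn, mul_comm]

theorem thetaProd_ne_zero (hq0 : q ≠ 0) (hq : ‖q‖ < 1) {y : ℂ} (hy : y ≠ 0)
    (h : ∀ m : ℤ, y ≠ q ^ m) : thetaProd q y ≠ 0 := fun h0 =>
  let ⟨m, hm⟩ := exists_eq_zpow_of_thetaProd_eq_zero hq0 hq hy h0
  h m hm

theorem analyticAt_thetaProd (hq : ‖q‖ < 1) {y : ℂ} (hy : y ≠ 0) :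
    AnalyticAt ℂ (thetaProd q) y :=
  (analyticAt_qInf hq y).mul
    ((analyticAt_qInf hq (q / y)).comp (analyticAt_const.div analyticAt_id hy))

theorem analyticOrderAt_thetaProd_le_one (hq0 : q ≠ 0) (hq : ‖q‖ < 1) {y : ℂ} (hy : y ≠ 0) :
    analyticOrderAt (thetaProd q) y ≤ 1 := by
  have hdiv : AnalyticAt ℂ (fun y => q / y) y := analyticAt_const.div analyticAt_id hy
  have hderiv : deriv (fun y => q / y) y ≠ 0 := by
    simp only [div_eq_mul_inv, deriv_const_mul_field, deriv_inv]
    simp [hq0, hy]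
  have hcomp : analyticOrderAt (qInf q ∘ fun y => q / y) y ≤ 1 := by
    rw [analyticOrderAt_comp_of_deriv_ne_zero hdiv hderiv]
    exact analyticOrderAt_qInf_le_one hq0 hq _
  refine analyticOrderAt_mul_le_one (analyticAt_qInf hq y) ((analyticAt_qInf hq _).comp hdiv)
    (analyticOrderAt_qInf_le_one hq0 hq y) hcomp ?_
  by_contra! h
  obtain ⟨m, hm⟩ := (qInf_eq_zero_iff hq).1 h.1
  obtain ⟨n, hn⟩ := (qInf_eq_zero_iff hq).1 h.2
  refine pow_succ_ne_one hq (m + n) ?_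
  calc q ^ (m + n + 1) = y * q ^ m * (q / y * q ^ n) := by field_simp; ring
    _ = 1 := by rw [hm, hn, mul_one]

theorem analyticOrderAt_thetaProd_comp_le_one (hq0 : q ≠ 0) (hq : ‖q‖ < 1) {f : ℂ → ℂ} {x : ℂ}
    (hf : AnalyticAt ℂ f x) (hf' : deriv f x ≠ 0) (hfx : f x ≠ 0) :
    analyticOrderAt (thetaProd q ∘ f) x ≤ 1 := by
  rw [analyticOrderAt_comp_of_deriv_ne_zero hf hf']
  exact analyticOrderAt_thetaProd_le_one hq0 hq hfx

end ThetaProduct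

section ThetaSeries

open Function.Periodic (qParam cuspFunction)

variable {q : ℂ}

theorem laurent_coeff_eq_zero_of_tsum_eq_zero {c : ℤ → ℂ} (hc : Summable c)
    (h : ∀ x : ℂ, ‖x‖ = 1 → ∑' n, c n * x ^ n = 0) (m : ℤ) : c m = 0 := by
  have : Fact (0 < (1 : ℝ)) := ⟨one_pos⟩
  have hsum : Summable fun n => c n • (fourier n : C(AddCircle (1 : ℝ), ℂ)) :=
    .of_norm (by simpa only [norm_smul, fourier_norm, mul_one] using hc.norm)
  have hzero : ∑' n, c n • (fourier n : C(AddCircle (1 : ℝ), ℂ)) = 0 := by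
    ext t
    rw [ContinuousMap.zero_apply, ← h _ (Circle.norm_coe t.toCircle),
      ← ContinuousMap.tsum_apply hsum]
    simp [fourier_apply, AddCircle.toCircle_zsmul]
  have hL2 : HasSum (fun n => c n • fourierLp (T := 1) 2 n) 0 := by
    simpa only [hzero, map_smul, map_zero] using
      hsum.hasSum.mapL (ContinuousMap.toLp (E := ℂ) 2 AddCircle.haarAddCircle ℂ)
  have hinner := hL2.mapL (innerSL ℂ (fourierLp (T := 1) 2 m))
  simp only [map_smul, map_zero, innerSL_apply_apply, smul_eq_mul,
    orthonormal_iff_ite.1 orthonormal_fourier, mul_ite, mul_one, mul_zero] at hinner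
  simpa only [if_true] using
    (hasSum_single m fun n (hn : n ≠ m) => if_neg (h := inferInstance) hn.symm).unique hinner

/-- The `n`-th term of the theta series, without the normalising factor `1 / (q;q)_∞`. -/
def thetaTerm (q : ℂ) (n : ℤ) (x : ℂ) : ℂ := (-1) ^ n * q ^ (n * (n - 1) / 2) * x ^ n

theorem triangular_add_one (n : ℤ) : (n + 1) * (n + 1 - 1) / 2 = n * (n - 1) / 2 + n := by
  rw [show (n + 1) * (n + 1 - 1) = n * (n - 1) + n * 2 by ring,
    Int.add_mul_ediv_right _ _ two_ne_zero]

theorem thetaTerm_q_mul (hq0 : q ≠ 0) {x : ℂ} (hx : x ≠ 0) (n : ℤ) :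
    -x * thetaTerm q n (q * x) = thetaTerm q (n + 1) x := by
  rw [thetaTerm, thetaTerm, triangular_add_one, zpow_add₀ hq0, mul_zpow, zpow_add_one₀ hx,
    zpow_add_one₀ (neg_ne_zero.2 one_ne_zero)]
  ring

theorem exists_qParam_eq (hq0 : q ≠ 0) (hq : ‖q‖ < 1) : ∃ τ : ℂ, 0 < τ.im ∧ qParam 1 τ = q := by
  refine ⟨Function.Periodic.invQParam 1 q, ?_, Function.Periodic.qParam_right_inv one_ne_zero hq0⟩
  rw [Function.Periodic.im_invQParam]
  exact mul_pos_of_neg_of_neg (div_neg_of_neg_of_pos (by simp) (by positivity))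
    (Real.log_neg (norm_pos_iff.2 hq0) hq)

theorem thetaTerm_qParam (τ u : ℂ) (n : ℤ) :
    thetaTerm (qParam 1 τ) n (qParam 1 u) = jacobiTheta₂_term n (u - τ / 2 + 1 / 2) τ := by
  have hexp : ((n * (n - 1) / 2 : ℤ) : ℂ) = n * (n - 1) / 2 := by
    rw [Int.cast_div (Int.even_mul_pred_self n).two_dvd (by norm_num)]
    push_cast
    ring
  rw [thetaTerm, jacobiTheta₂_term, qParam, qParam, ← Complex.exp_pi_mul_I]
  simp only [← Complex.exp_int_mul, ← Complex.exp_add, hexp]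
  congr 1
  push_cast
  ring

theorem theta_qParam (τ u : ℂ) :
    theta (qParam 1 τ) (qParam 1 u)
      = (qInf (qParam 1 τ) (qParam 1 τ))⁻¹ * jacobiTheta₂ (u - τ / 2 + 1 / 2) τ :=
  congrArg _ (tsum_congr (thetaTerm_qParam τ u))

theorem summable_thetaTerm (hq0 : q ≠ 0) (hq : ‖q‖ < 1) {x : ℂ} (hx : x ≠ 0) :
    Summable fun n => thetaTerm q n x := by
  obtain ⟨τ, hτ, rfl⟩ := exists_qParam_eq hq0 hq
  rw [← Function.Periodic.qParam_right_inv one_ne_zero hx]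
  simp only [thetaTerm_qParam]
  exact (summable_jacobiTheta₂_term_iff _ τ).2 hτ

theorem differentiableAt_theta (hq0 : q ≠ 0) (hq : ‖q‖ < 1) {x : ℂ} (hx : x ≠ 0) :
    DifferentiableAt ℂ (theta q) x := by
  obtain ⟨τ, hτ, rfl⟩ := exists_qParam_eq hq0 hq
  set F : ℂ → ℂ := fun u => jacobiTheta₂ (u - τ / 2 + 1 / 2) τ with hF
  have hper : Function.Periodic F (1 : ℝ) := fun u => by
    rw [hF, Complex.ofReal_one]
    beta_reduce
    rw [← jacobiTheta₂_add_left (u - τ / 2 + 1 / 2)]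
    ring_nf
  have hdiff : DifferentiableAt ℂ F (Function.Periodic.invQParam 1 x) :=
    (differentiableAt_jacobiTheta₂_fst _ hτ).comp _ (by fun_prop)
  have hcusp := Function.Periodic.differentiableAt_cuspFunction one_ne_zero hper hdiff
  rw [Function.Periodic.qParam_right_inv one_ne_zero hx] at hcusp
  refine (hcusp.const_mul (qInf (qParam 1 τ) (qParam 1 τ))⁻¹).congr_of_eventuallyEq ?_
  filter_upwards [isOpen_ne.mem_nhds hx] with y hy
  rw [← Function.Periodic.qParam_right_inv one_ne_zero hy, theta_qParam,
    Function.Periodic.eq_cuspFunction one_ne_zero hper]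

theorem analyticOnNhd_theta (hq0 : q ≠ 0) (hq : ‖q‖ < 1) : AnalyticOnNhd ℂ (theta q) {0}ᶜ :=
  DifferentiableOn.analyticOnNhd
    (fun _ hx => (differentiableAt_theta hq0 hq hx).differentiableWithinAt) isOpen_ne

theorem neg_mul_theta_q_mul (hq0 : q ≠ 0) {x : ℂ} (hx : x ≠ 0) :
    -x * theta q (q * x) = theta q x := by
  rw [theta, theta, mul_left_comm, ← tsum_mul_left, ← (Equiv.addRight (1 : ℤ)).tsum_eq
    fun n : ℤ => (-1 : ℂ) ^ n * q ^ (n * (n - 1) / 2) * x ^ n]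
  exact congrArg _ (tsum_congr (thetaTerm_q_mul hq0 hx))

theorem theta_one : theta q 1 = 0 := by
  have hodd (n : ℤ) : thetaTerm q (1 - n) 1 = -thetaTerm q n 1 := by
    rw [thetaTerm, thetaTerm, show (1 - n) * (1 - n - 1) = n * (n - 1) by ring,
      zpow_sub₀ (neg_ne_zero.2 one_ne_zero), zpow_one, one_zpow, one_zpow, div_eq_mul_inv,
      ← inv_zpow, inv_neg_one]
    ring
  have hsum : ∑' n, thetaTerm q n 1 = -∑' n, thetaTerm q n 1 := by
    conv_lhs => rw [← (Equiv.subLeft (1 : ℤ)).tsum_eq]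
    rw [← tsum_neg]
    exact tsum_congr hodd
  exact mul_eq_zero_of_right _ (self_eq_neg.1 hsum)

theorem theta_zpow (hq0 : q ≠ 0) (m : ℤ) : theta q (q ^ m) = 0 := by
  have h := apply_zpow_mul_of_periodic hq0 (f := fun x => theta q x = 0) (fun x hx => by
    rw [← neg_mul_theta_q_mul hq0 hx, mul_eq_zero_iff_left (neg_ne_zero.2 hx)]) m one_ne_zero
  simpa only [mul_one, theta_one, eq_self, eq_iff_iff, iff_true] using h

theorem exists_theta_ne_zero (hq0 : q ≠ 0) (hq : ‖q‖ < 1) : ∃ x ≠ 0, theta q x ≠ 0 := by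
  by_contra! h
  have hsum : Summable fun n : ℤ => (-1 : ℂ) ^ n * q ^ (n * (n - 1) / 2) := by
    simpa only [thetaTerm, one_zpow, mul_one] using summable_thetaTerm hq0 hq one_ne_zero
  have h0 := laurent_coeff_eq_zero_of_tsum_eq_zero hsum (fun x hx =>
    (mul_eq_zero_iff_left (inv_ne_zero (qInf_self_ne_zero hq))).1
      (h x (norm_pos_iff.1 (hx ▸ one_pos)))) 0
  simp at h0

theorem exists_theta_eq_const_mul_thetaProd (hq0 : q ≠ 0) (hq : ‖q‖ < 1) :
    ∃ K ≠ 0, ∀ x ≠ 0, theta q x = K * thetaProd q x := by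
  have hprod : AnalyticOnNhd ℂ (thetaProd q) {0}ᶜ := fun x hx => analyticAt_thetaProd hq hx
  have hord (x : ℂ) (hx : x ≠ 0) := analyticOrderAt_thetaProd_le_one hq0 hq hx
  obtain ⟨K, hK⟩ := exists_eq_const_mul_of_q_multiplier hq0 hq (analyticOnNhd_theta hq0 hq) hprod
    (fun x hx => ne_top_of_le_ne_top ENat.one_ne_top (hord x hx))
    (fun x hx => analyticOrderAt_le_of_le_one (analyticOnNhd_theta hq0 hq x hx) (hord x hx)
      fun h0 => by
        obtain ⟨m, rfl⟩ := exists_eq_zpow_of_thetaProd_eq_zero hq0 hq hx h0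
        exact theta_zpow hq0 m)
    (fun x hx => neg_mul_theta_q_mul hq0 hx) (fun x hx => neg_mul_thetaProd_q_mul hq0 hq hx)
  refine ⟨K, ?_, hK⟩
  rintro rfl
  obtain ⟨x, hx, h⟩ := exists_theta_ne_zero hq0 hq
  exact h (by rw [hK x hx, zero_mul])

end ThetaSeries

section IntegerIndex

variable {q : ℂ}

theorem qPoch_natCast (q x : ℂ) (n : ℕ) :
    qPoch q x n = ∏ j ∈ Finset.range n, (1 - x * q ^ j) := rfl

theorem qPoch_neg_natCast (q x : ℂ) (n : ℕ) :
    qPoch q x (-n) = (∏ j ∈ Finset.range n, (1 - x * (q ^ (j + 1))⁻¹))⁻¹ := by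
  cases n with
  | zero => simp [qPoch]
  | succ n => rfl

theorem qPoch_add_one (x : ℂ) {n : ℤ} (h : n < 0 → x * q ^ n ≠ 1) :
    qPoch q x (n + 1) = qPoch q x n * (1 - x * q ^ n) := by
  obtain ⟨m, rfl | rfl⟩ := n.eq_nat_or_neg
  · rw [← Nat.cast_succ, qPoch_natCast, qPoch_natCast, Finset.prod_range_succ, zpow_natCast]
  cases m with
  | zero => simp [qPoch]
  | succ m =>
    have hne := sub_ne_zero.2 (h (by omega)).symm
    rw [zpow_neg, zpow_natCast] at hne ⊢
    rw [qPoch_neg_natCast, Finset.prod_range_succ, mul_inv, inv_mul_cancel_right₀ hne,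
      ← qPoch_neg_natCast]
    congr 1
    push_cast
    ring

theorem inv_qPoch (hq0 : q ≠ 0) (hq : ‖q‖ < 1) {x : ℂ} (hx : qInf q x ≠ 0) (n : ℤ) :
    (qPoch q x n)⁻¹ = qInf q (q ^ n * x) / qInf q x := by
  obtain ⟨m, rfl | rfl⟩ := n.eq_nat_or_neg
  · have h := prod_mul_qInf hq x m
    rw [← h] at hx ⊢
    rw [qPoch_natCast, zpow_natCast, div_mul_cancel_right₀ (right_ne_zero_of_mul hx)]
  · have h := prod_mul_qInf hq (q ^ (-(m : ℤ)) * x) m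
    rw [← mul_assoc, ← zpow_natCast, ← zpow_add₀ hq0, add_neg_cancel, zpow_zero, one_mul,
      ← Finset.prod_range_reflect] at h
    rw [← h, mul_div_cancel_right₀ _ hx, qPoch_neg_natCast, inv_inv]
    refine Finset.prod_congr rfl fun j hj => ?_
    have hjm : (-(m : ℤ)) + (m - 1 - j : ℕ) = -((j + 1 : ℕ) : ℤ) := by
      have := Finset.mem_range.1 hj
      omega
    rw [mul_right_comm, ← zpow_natCast q (m - 1 - j), ← zpow_add₀ hq0, hjm, zpow_neg, zpow_natCast,
      mul_comm]

theorem qInf_q_div_mul_zpow_add_one (hq0 : q ≠ 0) (hq : ‖q‖ < 1) {u : ℂ} (hu : u ≠ 0) (n : ℤ) :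
    qInf q (q / (u * q ^ (n + 1))) * (-u) ^ (n + 1) * q ^ ((n + 1) * (n + 1 - 1) / 2)
      = qInf q (q / (u * q ^ n)) * (-u) ^ n * q ^ (n * (n - 1) / 2) * (1 - u * q ^ n) := by
  have hqn : q ^ n ≠ 0 := zpow_ne_zero n hq0
  have harg : q * (q / (u * q ^ (n + 1))) = q / (u * q ^ n) := by
    rw [zpow_add_one₀ hq0]
    field_simp
  have hfactor : (1 - q / (u * q ^ (n + 1))) * (-u * q ^ n) = 1 - u * q ^ n := by
    rw [zpow_add_one₀ hq0]
    field_simp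
    ring
  rw [qInf_eq_one_sub_mul hq (q / (u * q ^ (n + 1))), harg, triangular_add_one,
    zpow_add₀ hq0 (n * (n - 1) / 2), zpow_add_one₀ (neg_ne_zero.2 hu)]
  linear_combination
    qInf q (q / (u * q ^ n)) * (-u) ^ n * q ^ (n * (n - 1) / 2) * hfactor

theorem qPoch_mul_qInf (hq0 : q ≠ 0) (hq : ‖q‖ < 1) {u : ℂ} (hu : u ≠ 0) {n : ℤ}
    (h : n < 0 → qInf q (q / u) ≠ 0) :
    qPoch q u n * qInf q (q / u)
      = qInf q (q / (u * q ^ n)) * (-u) ^ n * q ^ (n * (n - 1) / 2) := by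
  induction n with
  | zero => simp [qPoch]
  | succ n ih =>
    rw [qPoch_add_one u (fun hn => absurd hn (by simp)), qInf_q_div_mul_zpow_add_one hq0 hq hu,
      ← ih (fun hn => absurd hn (by simp))]
    ring
  | pred n ih =>
    have hqInf := h (by omega)
    have hne : u * q ^ (-(n : ℤ) - 1) ≠ 1 := fun h1 => by
      refine hqInf ((qInf_eq_zero_iff hq).2 ⟨n, ?_⟩)
      have hu1 : u = q ^ (n + 1) := by
        rwa [show -(n : ℤ) - 1 = -((n + 1 : ℕ) : ℤ) by push_cast; ring, zpow_neg, zpow_natCast,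
          mul_inv_eq_one₀ (pow_ne_zero _ hq0)] at h1
      rw [hu1, pow_succ']
      field_simp
    refine mul_right_cancel₀ (sub_ne_zero.2 hne.symm) ?_
    rw [← qInf_q_div_mul_zpow_add_one hq0 hq hu, mul_right_comm, ← qPoch_add_one u fun _ => hne,
      sub_add_cancel, ih fun _ => hqInf]

theorem qPoch_q_mul_div_qPoch (hq0 : q ≠ 0) (hq : ‖q‖ < 1) {y : ℂ} {n : ℤ}
    (hy : qInf q y ≠ 0) (hn : qInf q (q ^ n * y) ≠ 0) :
    qPoch q (q * y) n / qPoch q y n = (1 - y * q ^ n) / (1 - y) := by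
  have hn' : qInf q (q ^ n * y) = (1 - y * q ^ n) * qInf q (q ^ n * (q * y)) := by
    rw [qInf_eq_one_sub_mul hq, mul_comm y, mul_left_comm q]
  have hy' := qInf_eq_one_sub_mul hq y
  rw [hn'] at hn
  rw [hy'] at hy
  have hy1 := left_ne_zero_of_mul hy
  have hy2 := right_ne_zero_of_mul hy
  have hn2 := right_ne_zero_of_mul hn
  rw [qPoch_eq_div hq0 hq (q * y) n hy2 hn2, div_eq_mul_inv,
    inv_qPoch hq0 hq (hy' ▸ hy) n, hn', hy']
  generalize qInf q (q * y) = u at *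
  generalize qInf q (q ^ n * (q * y)) = v at *
  field_simp

theorem qPoch_sqrt_factor (hq0 : q ≠ 0) (hq : ‖q‖ < 1) {s : ℂ} {n : ℤ}
    (hs : ∀ k ≥ min 0 n, s ^ 2 * q ^ (2 * k) ≠ 1) :
    qPoch q (q * s) n / qPoch q s n * (qPoch q (-(q * s)) n / qPoch q (-s) n)
      = (1 - s ^ 2 * q ^ (2 * n)) / (1 - s ^ 2) := by
  have hne (t : ℂ) (ht : t ^ 2 = s ^ 2) (m : ℤ) (hm : min 0 n ≤ m) : qInf q (q ^ m * t) ≠ 0 := by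
    rw [Ne, qInf_eq_zero_iff hq]
    rintro ⟨j, hj⟩
    refine hs (m + j) (by omega) ?_
    rw [← ht, ← one_pow 2, ← hj, mul_add, zpow_add₀ hq0, mul_comm 2 m, mul_comm 2 (j : ℤ), zpow_mul,
      zpow_mul, zpow_natCast q j]
    norm_cast
    ring
  have hratio (t : ℂ) (ht : t ^ 2 = s ^ 2) :
      qPoch q (q * t) n / qPoch q t n = (1 - t * q ^ n) / (1 - t) :=
    qPoch_q_mul_div_qPoch hq0 hq (by simpa using hne t ht 0 (min_le_left 0 n))
      (hne t ht n (min_le_right 0 n))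
  rw [← mul_neg, hratio s rfl, hratio (-s) (neg_sq s), div_mul_div_comm, mul_comm 2 n, zpow_mul]
  norm_cast
  ring_nf

theorem vwpPsiTerm_eq (hq0 : q ≠ 0) (hq : ‖q‖ < 1) {A : ℂ} (hA0 : A ≠ 0) (ps : List ℂ) (w : ℂ)
    {n : ℤ} (hA : ∀ k ≥ min 0 n, A * q ^ (2 * k) ≠ 1) :
    vwpPsiTerm q A ps w n = (1 - A * q ^ (2 * n)) / (1 - A)
      * (qPochL q ps n / qPochL q (ps.map fun α => A * q / α) n) * w ^ n := by
  obtain ⟨s, hs, hsA⟩ : ∃ s, A ^ (1 / 2 : ℂ) = s ∧ s ^ 2 = A :=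
    ⟨_, rfl, by simp⟩
  have hs0 : s ≠ 0 := by
    rintro rfl
    exact hA0 (by simpa using hsA.symm)
  have hlow : A * q / (q * s) = s := by
    rw [← hsA]
    field_simp
  rw [vwpPsiTerm, psiTerm, vwpLower, vwpUpper, hs, ← hsA, ← qPoch_sqrt_factor hq0 hq (hsA ▸ hA),
    hsA]
  simp only [qPochL, List.map_cons, List.prod_cons, div_neg, hlow]
  ring

theorem WTerm_eq_vwpPsiTerm {A : ℂ} (hA0 : A ≠ 0) (ps : List ℂ) (w : ℂ) (n : ℕ) :
    WTerm q A ps w n = vwpPsiTerm q A (A :: ps) w n := by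
  simp only [WTerm, phiTerm, vwpPsiTerm, psiTerm, vwpLower, vwpUpper, qPochL, List.map_cons,
    List.prod_cons, mul_div_cancel_left₀ q hA0, zpow_natCast]
  ring

end IntegerIndex

section RegularizedTerms

variable {ι : Type*} [Fintype ι] {q a w : ℂ} {p : ι → ℂ}

/-- `Ω(x; p) = ∏ᵢ (x / pᵢ; q)_∞` for a family of parameters `p`. -/
def omegaProd (q : ℂ) (p : ι → ℂ) (x : ℂ) : ℂ := ∏ i, qInf q (x / p i)

/-- The `n`-th term of the very-well-poised bilateral series with base `x² / a` and parameters
`pᵢ x / a`, multiplied by `(1 - x² / a) Ω(xq; p)`. This clears all denominators that depend on `x`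
as long as `n ≥ 0`. -/
def regTerm (q a : ℂ) (p : ι → ℂ) (w x : ℂ) (n : ℤ) : ℂ :=
  (1 - x ^ 2 / a * q ^ (2 * n)) * omegaProd q p (x * q * q ^ n)
    * (∏ i, qPoch q (p i * x / a) n) * w ^ n

/-- The nonnegative half of the series of the regularised terms `regTerm`. -/
def uniSum (q a : ℂ) (p : ι → ℂ) (w x : ℂ) : ℂ := ∑' n : ℕ, regTerm q a p w x n

/-- A bound for `‖regTerm q a p w x n‖ / ‖w‖ ^ n` that is uniform in `n ≥ 0`. -/
def regBound (q a : ℂ) (p : ι → ℂ) (x : ℂ) : ℝ :=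
  (1 + ‖x ^ 2 / a‖) * (∏ i, Real.exp (‖x / p i‖ / (1 - ‖q‖)))
    * ∏ i, Real.exp (‖p i * x / a‖ / (1 - ‖q‖))

theorem omegaProd_ne_zero_iff {x : ℂ} : omegaProd q p x ≠ 0 ↔ ∀ i, qInf q (x / p i) ≠ 0 := by
  simp [omegaProd, Finset.prod_ne_zero_iff]

theorem vwpPsiTerm_eq_regTerm_div (hq0 : q ≠ 0) (hq : ‖q‖ < 1) (ha : a ≠ 0) {N : ℕ}
    {p : Fin N → ℂ} (hp : ∀ i, p i ≠ 0) (w : ℂ) {x : ℂ} (hx : x ≠ 0) {n : ℤ}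
    (hA : ∀ k ≥ min 0 n, x ^ 2 / a * q ^ (2 * k) ≠ 1) (hΩ : omegaProd q p (x * q) ≠ 0) :
    vwpPsiTerm q (x ^ 2 / a) (List.ofFn fun i => p i * x / a) w n
      = regTerm q a p w x n / ((1 - x ^ 2 / a) * omegaProd q p (x * q)) := by
  have hlow (i : Fin N) : x ^ 2 / a * q / (p i * x / a) = x * q / p i := by
    have := hp i
    field_simp
  have hinv : (∏ i, qPoch q (x * q / p i) n)⁻¹
      = omegaProd q p (x * q * q ^ n) / omegaProd q p (x * q) := by
    rw [omegaProd, omegaProd, ← Finset.prod_inv_distrib, ← Finset.prod_div_distrib]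
    refine Finset.prod_congr rfl fun i _ => ?_
    rw [inv_qPoch hq0 hq (omegaProd_ne_zero_iff.1 hΩ i), mul_div_assoc', mul_comm (q ^ n)]
  rw [vwpPsiTerm_eq hq0 hq (by positivity) _ _ hA]
  simp only [qPochL, List.map_ofFn, List.prod_ofFn, Function.comp_apply, hlow, regTerm]
  rw [div_eq_mul_inv (∏ i, _) (∏ i, _), hinv, mul_comm (1 - x ^ 2 / a) (omegaProd q p (x * q))]
  field_simp

theorem norm_regTerm_le (hq : ‖q‖ < 1) (x : ℂ) (n : ℕ) :
    ‖regTerm q a p w x n‖ ≤ regBound q a p x * ‖w‖ ^ n := by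
  have hpow (m : ℕ) : ‖q‖ ^ m ≤ 1 := pow_le_one₀ (norm_nonneg q) hq.le
  have hvwp : ‖1 - x ^ 2 / a * q ^ (2 * (n : ℤ))‖ ≤ 1 + ‖x ^ 2 / a‖ := by
    refine (norm_sub_le _ _).trans ?_
    rw [norm_one, norm_mul]
    gcongr
    exact mul_le_of_le_one_right (norm_nonneg _) (by simpa using mod_cast hpow (2 * n))
  have hden (i : ι) : ‖qInf q (x * q * q ^ (n : ℤ) / p i)‖
      ≤ Real.exp (‖x / p i‖ / (1 - ‖q‖)) := by
    refine (norm_qInf_le hq _).trans ?_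
    have : ‖x * q * q ^ (n : ℤ) / p i‖ ≤ ‖x / p i‖ := by
      rw [show x * q * q ^ (n : ℤ) / p i = x / p i * q ^ (n + 1) by
        rw [zpow_natCast, pow_succ]; ring, norm_mul, norm_pow]
      exact mul_le_of_le_one_right (norm_nonneg _) (hpow _)
    have := sub_pos.2 hq
    gcongr
  rw [regTerm, regBound, norm_mul, norm_mul, norm_mul, omegaProd, norm_prod, norm_prod, norm_zpow,
    zpow_natCast ‖w‖]
  gcongr with i _ i _
  · exact hden i
  · rw [qPoch_natCast]
    exact norm_prod_one_sub_le hq _ n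

theorem regBound_nonneg (x : ℂ) : 0 ≤ regBound q a p x := by
  unfold regBound
  positivity

theorem summable_regTerm (hq : ‖q‖ < 1) (hw : ‖w‖ < 1) (x : ℂ) :
    Summable fun n : ℕ => regTerm q a p w x n :=
  .of_norm_bounded ((summable_geometric_of_lt_one (norm_nonneg w) hw).mul_left _)
    (norm_regTerm_le hq x)

section Continuity

variable {X : Type*} [TopologicalSpace X] {P : X → ι → ℂ} {v y : X → ℂ} {t : X}

theorem continuousAt_omegaProd (hq : ‖q‖ < 1) (hP : ContinuousAt P t) (hP0 : ∀ i, P t i ≠ 0)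
    (hy : ContinuousAt y t) : ContinuousAt (fun s => omegaProd q (P s) (y s)) t :=
  tendsto_finsetProd _ fun i _ => (continuous_qInf hq).continuousAt.comp
    (hy.div (continuousAt_pi.1 hP i) (hP0 i))

theorem continuousAt_regTerm (hq : ‖q‖ < 1) (hP : ContinuousAt P t) (hP0 : ∀ i, P t i ≠ 0)
    (hv : ContinuousAt v t) (hy : ContinuousAt y t) (n : ℕ) :
    ContinuousAt (fun s => regTerm q a (P s) (v s) (y s) n) t := by
  have hPi := continuousAt_pi.1 hP
  have hΩ := continuousAt_omegaProd (y := fun s => y s * q * q ^ (n : ℤ)) hq hP hP0 (by fun_prop)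
  have hprod : ContinuousAt
      (fun s => ∏ i, ∏ j ∈ Finset.range n, (1 - P s i * y s / a * q ^ j)) t :=
    tendsto_finsetProd _ fun i _ => tendsto_finsetProd _ fun j _ =>
      tendsto_const_nhds.sub ((((hPi i).mul hy).div_const a).mul_const _)
  simp only [regTerm, qPoch_natCast, zpow_natCast] at hΩ ⊢
  exact (((continuousAt_const.sub (((hy.pow 2).div_const a).mul_const _)).mul hΩ).mul hprod).mul
    (hv.pow n)

theorem continuousAt_regBound (hP : ContinuousAt P t) (hP0 : ∀ i, P t i ≠ 0)
    (hy : ContinuousAt y t) : ContinuousAt (fun s => regBound q a (P s) (y s)) t := by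
  have hPi := continuousAt_pi.1 hP
  exact ((continuousAt_const.add ((hy.pow 2).div_const a).norm).mul
    (tendsto_finsetProd _ fun i _ => ((hy.div (hPi i) (hP0 i)).norm.div_const _).rexp)).mul
    (tendsto_finsetProd _ fun i _ => ((((hPi i).mul hy).div_const a).norm.div_const _).rexp)

theorem continuousAt_uniSum (hq : ‖q‖ < 1) (hP : ContinuousAt P t) (hP0 : ∀ i, P t i ≠ 0)
    (hv : ContinuousAt v t) (hv1 : ‖v t‖ < 1) (hy : ContinuousAt y t) :
    ContinuousAt (fun s => uniSum q a (P s) (v s) (y s)) t := by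
  obtain ⟨ρ, hvρ, hρ⟩ := exists_between hv1
  refine tendsto_tsum_of_dominated_convergence
    ((summable_geometric_of_lt_one ((norm_nonneg _).trans hvρ.le) hρ).mul_left
      (regBound q a (P t) (y t) + 1)) (continuousAt_regTerm hq hP hP0 hv hy) ?_
  filter_upwards [(continuousAt_regBound hP hP0 hy).eventually_le_const (lt_add_one _),
    hv.norm.eventually_le_const hvρ] with s hs hvs n
  refine (norm_regTerm_le hq _ n).trans ?_
  gcongr
  exact (regBound_nonneg _).trans hs

end Continuity

theorem analyticAt_omegaProd (hq : ‖q‖ < 1) (p : ι → ℂ) (x : ℂ) :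
    AnalyticAt ℂ (omegaProd q p) x :=
  Finset.analyticAt_fun_prod _ fun i _ => (analyticAt_qInf hq _).comp (by fun_prop)

theorem differentiable_regTerm (hq : ‖q‖ < 1) (n : ℕ) :
    Differentiable ℂ fun x => regTerm q a p w x n := by
  have hΩ : Differentiable ℂ (omegaProd q p) := fun x =>
    (analyticAt_omegaProd hq p x).differentiableAt
  simp only [regTerm, qPoch_natCast]
  fun_prop

theorem differentiable_uniSum (hq : ‖q‖ < 1) (hw : ‖w‖ < 1) (hp : ∀ i, p i ≠ 0) :
    Differentiable ℂ (uniSum q a p w) := fun x => by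
  have hbound : ∀ᶠ y in 𝓝 x, regBound q a p y ≤ regBound q a p x + 1 :=
    (continuousAt_regBound continuousAt_const hp continuousAt_id).eventually_le_const (lt_add_one _)
  obtain ⟨U, hU, hUo, hxU⟩ := eventually_nhds_iff.1 hbound
  refine (Complex.differentiableOn_tsum_of_summable_norm
    ((summable_geometric_of_lt_one (norm_nonneg w) hw).mul_left (regBound q a p x + 1))
    (fun n => (differentiable_regTerm hq n).differentiableOn) hUo fun n y hy =>
      (norm_regTerm_le hq y n).trans ?_).differentiableAt (hUo.mem_nhds hxU)
  gcongr
  exact hU y hy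

end RegularizedTerms

section WellPoisedSum

variable {ι : Type*} [Fintype ι] {q a : ℂ} {r : ℕ} {p : ι → ℂ}

/-- The automorphy factor of degree `1` for the action of `q ^ ℤ` on `ℂˣ`: the factor by which
`θ(xy / a) θ(y / x)` is divided under `x ↦ q ^ n * x`, whatever `y`. -/
def thetaFactor (q a : ℂ) (n : ℤ) (x : ℂ) : ℂ := q ^ (n ^ 2) * (x ^ 2 / a) ^ n

/-- The term of index `0` of the regularised very-well-poised series, normalised to be odd
under `x ↦ a / x`. -/
def wpKernel (q a : ℂ) (p : ι → ℂ) (x : ℂ) : ℂ :=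
  (x⁻¹ - x / a) * (omegaProd q p (x * q) * omegaProd q p (a * q / x))

/-- The `n`-th translate of `wpKernel` with respect to the automorphy factor `thetaFactor ^ r`. -/
def wpTerm (q a : ℂ) (r : ℕ) (p : ι → ℂ) (n : ℤ) (x : ℂ) : ℂ :=
  thetaFactor q a n x ^ r * wpKernel q a p (q ^ n * x)

/-- The regularised very-well-poised bilateral series: the average of `wpKernel` over `q ^ ℤ`. -/
def wpSum (q a : ℂ) (r : ℕ) (p : ι → ℂ) (x : ℂ) : ℂ := ∑' n : ℤ, wpTerm q a r p n x

/-- The argument of the very-well-poised series with `2 r` parameters, `r = 3` being the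
`₈ψ₈`-series. -/
def wpArg (q a : ℂ) (r : ℕ) (p : ι → ℂ) : ℂ := (a * q) ^ r / (q * ∏ i, p i)

theorem thetaFactor_add (hq0 : q ≠ 0) (ha : a ≠ 0) (m n : ℤ) {x : ℂ} (hx : x ≠ 0) :
    thetaFactor q a (m + n) x = thetaFactor q a m (q ^ n * x) * thetaFactor q a n x := by
  have hxa : x ^ 2 / a ≠ 0 := div_ne_zero (pow_ne_zero 2 hx) ha
  have hbase : (q ^ n * x) ^ 2 / a = q ^ (2 * n) * (x ^ 2 / a) := by
    rw [mul_comm 2 n, zpow_mul]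
    norm_cast
    ring
  rw [thetaFactor, thetaFactor, thetaFactor, hbase, mul_zpow, ← zpow_mul, zpow_add₀ hxa,
    show (m + n) ^ 2 = m ^ 2 + 2 * n * m + n ^ 2 by ring, zpow_add₀ hq0, zpow_add₀ hq0]
  ring

theorem thetaFactor_ne_zero (hq0 : q ≠ 0) (ha : a ≠ 0) (n : ℤ) {x : ℂ} (hx : x ≠ 0) :
    thetaFactor q a n x ≠ 0 :=
  mul_ne_zero (zpow_ne_zero _ hq0) (zpow_ne_zero _ (div_ne_zero (pow_ne_zero 2 hx) ha))

theorem thetaFactor_neg (ha : a ≠ 0) (n : ℤ) {x : ℂ} (hx : x ≠ 0) :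
    thetaFactor q a (-n) x = thetaFactor q a n (a / x) := by
  have hbase : (x ^ 2 / a)⁻¹ = (a / x) ^ 2 / a := by field_simp
  rw [thetaFactor, thetaFactor, neg_sq, zpow_neg, ← inv_zpow, hbase]

theorem wpKernel_div (ha : a ≠ 0) {x : ℂ} (hx : x ≠ 0) :
    wpKernel q a p (a / x) = -wpKernel q a p x := by
  have h : a * q / (a / x) = x * q := by field_simp
  rw [wpKernel, wpKernel, h, div_mul_eq_mul_div, inv_div, div_div_cancel_left' ha]
  ring

theorem wpTerm_neg (hq0 : q ≠ 0) (ha : a ≠ 0) (n : ℤ) {x : ℂ} (hx : x ≠ 0) :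
    wpTerm q a r p (-n) x = -wpTerm q a r p n (a / x) := by
  have hqn := zpow_ne_zero n hq0
  have harg : q ^ n * (a / x) = a / (q ^ (-n) * x) := by
    rw [zpow_neg]
    field_simp
  rw [wpTerm, wpTerm, thetaFactor_neg ha n hx, harg,
    wpKernel_div ha (mul_ne_zero (zpow_ne_zero _ hq0) hx), mul_neg, neg_neg]

theorem wpTerm_add (hq0 : q ≠ 0) (ha : a ≠ 0) (m n : ℤ) {x : ℂ} (hx : x ≠ 0) :
    wpTerm q a r p (m + n) x = thetaFactor q a n x ^ r * wpTerm q a r p m (q ^ n * x) := by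
  rw [wpTerm, wpTerm, thetaFactor_add hq0 ha m n hx, zpow_add₀ hq0, mul_pow, mul_assoc (q ^ m)]
  ring

theorem thetaFactor_pow_mul_wpSum (hq0 : q ≠ 0) (ha : a ≠ 0) (n : ℤ) {x : ℂ} (hx : x ≠ 0) :
    thetaFactor q a n x ^ r * wpSum q a r p (q ^ n * x) = wpSum q a r p x := by
  simp only [wpSum, ← tsum_mul_left, ← wpTerm_add hq0 ha _ n hx]
  exact (Equiv.addRight n).tsum_eq fun m => wpTerm q a r p m x

theorem wpSum_div (hq0 : q ≠ 0) (ha : a ≠ 0) {x : ℂ} (hx : x ≠ 0) :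
    wpSum q a r p (a / x) = -wpSum q a r p x := by
  rw [wpSum, wpSum, ← (Equiv.neg ℤ).tsum_eq fun n => wpTerm q a r p n x, ← tsum_neg]
  exact tsum_congr fun n => by rw [Equiv.neg_apply, wpTerm_neg hq0 ha n hx, neg_neg]

theorem prod_qPoch_mul_omegaProd (hq0 : q ≠ 0) (hq : ‖q‖ < 1) (ha : a ≠ 0) (hp : ∀ i, p i ≠ 0)
    (hr : Fintype.card ι = 2 * r) {x : ℂ} (hx : x ≠ 0) {n : ℤ}
    (hn : n < 0 → omegaProd q p (a * q / x) ≠ 0) :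
    (∏ i, qPoch q (p i * x / a) n) * omegaProd q p (a * q / x)
      = omegaProd q p (a * q / (q ^ n * x))
        * (((x / a) ^ (2 * r) * ∏ i, p i) ^ n * q ^ (r * (n * (n - 1)))) := by
  have hfactor (i : ι) : qPoch q (p i * x / a) n * qInf q (a * q / x / p i)
      = qInf q (a * q / (q ^ n * x) / p i)
        * ((-(x / a) * p i) ^ n * q ^ (n * (n - 1) / 2)) := by
    have hpi := hp i
    have hu : p i * x / a ≠ 0 := by positivity
    have hqu : q / (p i * x / a) = a * q / x / p i := by field_simp
    have hqun : q / (p i * x / a * q ^ n) = a * q / (q ^ n * x) / p i := by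
      have := zpow_ne_zero n hq0
      field_simp
    rw [← hqu, ← hqun, ← mul_assoc, show -(x / a) * p i = -(p i * x / a) by ring]
    exact qPoch_mul_qInf hq0 hq hu fun h => hqu ▸ omegaProd_ne_zero_iff.1 (hn h) i
  have hexp : n * (n - 1) / 2 * (2 * r : ℕ) = r * (n * (n - 1)) := by
    rw [← Int.ediv_mul_cancel (Int.even_mul_pred_self n).two_dvd, Int.mul_ediv_cancel _ two_ne_zero]
    push_cast
    ring
  rw [omegaProd, ← Finset.prod_mul_distrib, Finset.prod_congr rfl fun i _ => hfactor i,
    Finset.prod_mul_distrib, Finset.prod_mul_distrib, Finset.prod_zpow, Finset.prod_mul_distrib,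
    Finset.prod_const, Finset.prod_const, Finset.card_univ, hr, (even_two_mul r).neg_pow,
    ← zpow_natCast (q ^ _), ← zpow_mul, hexp, omegaProd]

theorem thetaFactor_pow (hq0 : q ≠ 0) (ha : a ≠ 0) (hp : ∀ i, p i ≠ 0) (n : ℤ) (x : ℂ) :
    thetaFactor q a n x ^ r = q ^ n * (wpArg q a r p ^ n
      * (((x / a) ^ (2 * r) * ∏ i, p i) ^ n * q ^ (r * (n * (n - 1))))) := by
  have hP : ∏ i, p i ≠ 0 := Finset.prod_ne_zero_iff.2 fun i _ => hp i
  have hbase : q * (wpArg q a r p * ((x / a) ^ (2 * r) * ∏ i, p i)) = q ^ r * (x ^ 2 / a) ^ r := by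
    calc q * (wpArg q a r p * ((x / a) ^ (2 * r) * ∏ i, p i))
        = (a * q) ^ r * ((x / a) ^ 2) ^ r := by
          rw [wpArg, pow_mul]
          field_simp
      _ = q ^ r * (x ^ 2 / a) ^ r := by
          rw [← mul_pow, ← mul_pow]
          field_simp
  rw [← mul_assoc (wpArg q a r p ^ n), ← mul_zpow, ← mul_assoc, ← mul_zpow, hbase, mul_zpow,
    thetaFactor, mul_pow, ← zpow_natCast (q ^ _), ← zpow_natCast (_ ^ n), ← zpow_natCast q,
    ← zpow_natCast (x ^ 2 / a), ← zpow_mul, ← zpow_mul, ← zpow_mul, ← zpow_mul, mul_right_comm,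
    ← zpow_add₀ hq0]
  ring_nf

theorem mul_wpTerm (hq0 : q ≠ 0) (hq : ‖q‖ < 1) (ha : a ≠ 0) (hp : ∀ i, p i ≠ 0)
    (hr : Fintype.card ι = 2 * r) {x : ℂ} (hx : x ≠ 0) {n : ℤ}
    (hn : n < 0 → omegaProd q p (a * q / x) ≠ 0) :
    x * wpTerm q a r p n x
      = omegaProd q p (a * q / x) * regTerm q a p (wpArg q a r p) x n := by
  have hqn := zpow_ne_zero n hq0
  have hvwp : x * ((q ^ n * x)⁻¹ - q ^ n * x / a) * q ^ n = 1 - x ^ 2 / a * q ^ (2 * n) := by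
    rw [mul_comm 2 n, zpow_mul, zpow_ofNat]
    field_simp
  rw [wpTerm, wpKernel, regTerm, thetaFactor_pow hq0 ha hp, ← hvwp,
    show q ^ n * x * q = x * q * q ^ n by ring]
  linear_combination -(x * ((q ^ n * x)⁻¹ - q ^ n * x / a) * q ^ n
    * omegaProd q p (x * q * q ^ n) * wpArg q a r p ^ n)
    * prod_qPoch_mul_omegaProd hq0 hq ha hp hr hx hn

end WellPoisedSum

section WellPoisedSummation

variable {ι : Type*} [Fintype ι] {q a : ℂ} {r : ℕ} {p : ι → ℂ}

/-- The sum of the terms of nonnegative index in `wpSum`. -/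
def wpHalfSum (q a : ℂ) (r : ℕ) (p : ι → ℂ) (x : ℂ) : ℂ :=
  x⁻¹ * (omegaProd q p (a * q / x) * uniSum q a p (wpArg q a r p) x)

theorem hasSum_wpTerm_natCast (hq0 : q ≠ 0) (hq : ‖q‖ < 1) (ha : a ≠ 0) (hp : ∀ i, p i ≠ 0)
    (hr : Fintype.card ι = 2 * r) (hw : ‖wpArg q a r p‖ < 1) {x : ℂ} (hx : x ≠ 0) :
    HasSum (fun n : ℕ => wpTerm q a r p n x) (wpHalfSum q a r p x) := by
  refine (((summable_regTerm hq hw x).hasSum.mul_left _).mul_left x⁻¹).congr_fun fun n => ?_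
  rw [← mul_wpTerm hq0 hq ha hp hr hx fun h => absurd h (by simp), inv_mul_cancel_left₀ hx]

theorem hasSum_wpTerm (hq0 : q ≠ 0) (hq : ‖q‖ < 1) (ha : a ≠ 0) (hp : ∀ i, p i ≠ 0)
    (hr : Fintype.card ι = 2 * r) (hw : ‖wpArg q a r p‖ < 1) {x : ℂ} (hx : x ≠ 0) :
    HasSum (fun n : ℤ => wpTerm q a r p n x)
      (wpHalfSum q a r p x - wpHalfSum q a r p (a / x) - wpKernel q a p x) := by
  have hneg : HasSum (fun n : ℕ => wpTerm q a r p (-n) x) (-wpHalfSum q a r p (a / x)) := by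
    simpa only [wpTerm_neg hq0 ha _ hx] using
      (hasSum_wpTerm_natCast hq0 hq ha hp hr hw (div_ne_zero ha hx)).neg
  have hzero : wpTerm q a r p 0 x = wpKernel q a p x := by simp [wpTerm, thetaFactor]
  rw [sub_eq_add_neg (wpHalfSum q a r p x), ← hzero]
  exact HasSum.of_nat_of_neg (f := fun n => wpTerm q a r p n x)
    (hasSum_wpTerm_natCast hq0 hq ha hp hr hw hx) hneg

theorem differentiableAt_wpHalfSum (hq : ‖q‖ < 1) (hp : ∀ i, p i ≠ 0) (hw : ‖wpArg q a r p‖ < 1)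
    {x : ℂ} (hx : x ≠ 0) : DifferentiableAt ℂ (wpHalfSum q a r p) x :=
  (differentiableAt_inv hx).mul (((analyticAt_omegaProd hq p _).differentiableAt.comp x
    (by fun_prop (disch := assumption))).mul (differentiable_uniSum hq hw hp x))

theorem differentiableAt_wpKernel (hq : ‖q‖ < 1) {x : ℂ} (hx : x ≠ 0) :
    DifferentiableAt ℂ (wpKernel q a p) x :=
  ((differentiableAt_inv hx).sub (by fun_prop)).mul
    (((analyticAt_omegaProd hq p _).differentiableAt.comp x (by fun_prop)).mul
      ((analyticAt_omegaProd hq p _).differentiableAt.comp x (by fun_prop (disch := assumption))))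

theorem analyticOnNhd_wpSum (hq0 : q ≠ 0) (hq : ‖q‖ < 1) (ha : a ≠ 0) (hp : ∀ i, p i ≠ 0)
    (hr : Fintype.card ι = 2 * r) (hw : ‖wpArg q a r p‖ < 1) :
    AnalyticOnNhd ℂ (wpSum q a r p) {0}ᶜ := by
  refine (DifferentiableOn.congr (fun x hx => ?_) fun x hx =>
    (hasSum_wpTerm hq0 hq ha hp hr hw hx).tsum_eq).analyticOnNhd isOpen_compl_singleton
  exact (((differentiableAt_wpHalfSum hq hp hw hx).sub
    ((differentiableAt_wpHalfSum hq hp hw (div_ne_zero ha hx)).comp x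
      ((differentiableAt_const a).div differentiableAt_id hx))).sub
    (differentiableAt_wpKernel hq hx)).differentiableWithinAt

theorem continuousAt_wpArg {X : Type*} [TopologicalSpace X] {P : X → ι → ℂ} {t : X} (hq0 : q ≠ 0)
    (hP : ContinuousAt P t) (hP0 : ∀ i, P t i ≠ 0) :
    ContinuousAt (fun s => wpArg q a r (P s)) t :=
  continuousAt_const.div (continuousAt_const.mul
    (tendsto_finsetProd _ fun i _ => continuousAt_pi.1 hP i))
    (mul_ne_zero hq0 (Finset.prod_ne_zero_iff.2 fun i _ => hP0 i))

theorem eventually_ne_zero_and_norm_wpArg_lt_one (hq0 : q ≠ 0) (hp : ∀ i, p i ≠ 0)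
    (hw : ‖wpArg q a r p‖ < 1) : ∀ᶠ p' in 𝓝 p, (∀ i, p' i ≠ 0) ∧ ‖wpArg q a r p'‖ < 1 :=
  (eventually_all.2 fun i => (continuous_apply i).continuousAt.eventually_ne (hp i)).and
    ((continuousAt_wpArg hq0 continuousAt_id hp).norm.eventually_lt_const hw)

theorem continuousAt_wpSum {X : Type*} [TopologicalSpace X] {P : X → ι → ℂ} {t : X}
    (hq0 : q ≠ 0) (hq : ‖q‖ < 1) (ha : a ≠ 0) (hP : ContinuousAt P t) (hP0 : ∀ i, P t i ≠ 0)
    (hr : Fintype.card ι = 2 * r) (hw : ‖wpArg q a r (P t)‖ < 1) {x : ℂ} (hx : x ≠ 0) :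
    ContinuousAt (fun s => wpSum q a r (P s) x) t := by
  have hΩ (y : ℂ) : ContinuousAt (fun s => omegaProd q (P s) y) t :=
    continuousAt_omegaProd hq hP hP0 continuousAt_const
  have hhalf (y : ℂ) : ContinuousAt (fun s => wpHalfSum q a r (P s) y) t :=
    continuousAt_const.mul ((hΩ _).mul (continuousAt_uniSum hq hP hP0
      (continuousAt_wpArg hq0 hP hP0) hw continuousAt_const))
  have hkernel : ContinuousAt (fun s => wpKernel q a (P s) x) t :=
    continuousAt_const.mul ((hΩ (x * q)).mul (hΩ (a * q / x)))
  refine (((hhalf x).sub (hhalf (a / x))).sub hkernel).congr ?_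
  filter_upwards [hP.eventually (eventually_ne_zero_and_norm_wpArg_lt_one hq0 hP0 hw)] with s hs
  exact (hasSum_wpTerm hq0 hq ha hs.1 hr hs.2 hx).tsum_eq.symm

theorem hasSum_vwpPsiTerm (hq0 : q ≠ 0) (hq : ‖q‖ < 1) (ha : a ≠ 0) {N : ℕ} {p : Fin N → ℂ}
    (hp : ∀ i, p i ≠ 0) (hr : N = 2 * r) (hw : ‖wpArg q a r p‖ < 1) {x : ℂ} (hx : x ≠ 0)
    (hxa : ∀ m : ℤ, x ^ 2 / a ≠ q ^ m)
    (hΩ : omegaProd q p (x * q) ≠ 0) (hΩ' : omegaProd q p (a * q / x) ≠ 0) :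
    HasSum (vwpPsiTerm q (x ^ 2 / a) (List.ofFn fun i => p i * x / a) (wpArg q a r p))
      (x * wpSum q a r p x
        / ((1 - x ^ 2 / a) * (omegaProd q p (x * q) * omegaProd q p (a * q / x)))) := by
  have hcard : Fintype.card (Fin N) = 2 * r := by rw [Fintype.card_fin, hr]
  have hA (k : ℤ) : x ^ 2 / a * q ^ (2 * k) ≠ 1 := fun h =>
    hxa (-(2 * k)) (by rw [zpow_neg, eq_inv_of_mul_eq_one_left h])
  refine (((hasSum_wpTerm hq0 hq ha hp hcard hw hx).summable.hasSum.mul_left x).div_const _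
    ).congr_fun fun n => ?_
  rw [vwpPsiTerm_eq_regTerm_div hq0 hq ha hp _ hx (fun k _ => hA k) hΩ,
    mul_wpTerm hq0 hq ha hp hcard hx fun _ => hΩ', mul_comm (omegaProd q p (a * q / x)),
    ← mul_assoc, mul_div_mul_right _ _ hΩ']

theorem hasSum_WTerm (hq0 : q ≠ 0) (hq : ‖q‖ < 1) (ha : a ≠ 0) {N : ℕ} {p : Fin (N + 1) → ℂ}
    (hp : ∀ i, p i ≠ 0) {w : ℂ} (hw : ‖w‖ < 1)
    (hA : ∀ n : ℕ, p 0 ^ 2 / a * q ^ (2 * n) ≠ 1) (hΩ : omegaProd q p (p 0 * q) ≠ 0) :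
    HasSum (WTerm q (p 0 ^ 2 / a) (List.ofFn fun i : Fin N => p 0 * p i.succ / a) w)
      (uniSum q a p w (p 0) / ((1 - p 0 ^ 2 / a) * omegaProd q p (p 0 * q))) := by
  have hA' (n : ℕ) (k : ℤ) (hk : k ≥ min 0 (n : ℤ)) : p 0 ^ 2 / a * q ^ (2 * k) ≠ 1 := by
    lift k to ℕ using by omega
    exact_mod_cast hA k
  refine ((summable_regTerm hq hw (p 0)).hasSum.div_const _).congr_fun fun n => ?_
  rw [WTerm_eq_vwpPsiTerm (div_ne_zero (pow_ne_zero 2 (hp 0)) ha),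
    ← vwpPsiTerm_eq_regTerm_div hq0 hq ha hp w (hp 0) (hA' n) hΩ, List.ofFn_succ, sq]
  simp only [mul_comm (p 0)]

end WellPoisedSummation

section OddTheta

variable {q a w : ℂ} {r : ℕ} {E F : ℂ → ℂ}

/-- Theta functions on `ℂˣ / q ^ ℤ` with automorphy factor `thetaFactor ^ r` that are odd under
the involution `x ↦ a / x`. -/
structure IsOddTheta (q a : ℂ) (r : ℕ) (E : ℂ → ℂ) : Prop where
  analyticOnNhd : AnalyticOnNhd ℂ E {0}ᶜ
  apply_q_mul : ∀ x ≠ 0, (q * (x ^ 2 / a)) ^ r * E (q * x) = E x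
  apply_div : ∀ x ≠ 0, E (a / x) = -E x

theorem isOddTheta_wpSum {ι : Type*} [Fintype ι] {p : ι → ℂ} (hq0 : q ≠ 0) (hq : ‖q‖ < 1)
    (ha : a ≠ 0) (hp : ∀ i, p i ≠ 0) (hr : Fintype.card ι = 2 * r)
    (hw : ‖wpArg q a r p‖ < 1) : IsOddTheta q a r (wpSum q a r p) where
  analyticOnNhd := analyticOnNhd_wpSum hq0 hq ha hp hr hw
  apply_q_mul x hx := by
    simpa [thetaFactor] using thetaFactor_pow_mul_wpSum (p := p) (r := r) hq0 ha 1 hx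
  apply_div _ hx := wpSum_div hq0 ha hx

namespace IsOddTheta

theorem sub (hE : IsOddTheta q a r E) (hF : IsOddTheta q a r F) : IsOddTheta q a r (E - F) where
  analyticOnNhd := hE.analyticOnNhd.sub hF.analyticOnNhd
  apply_q_mul x hx := by
    rw [Pi.sub_apply, Pi.sub_apply, mul_sub, hE.apply_q_mul x hx, hF.apply_q_mul x hx]
  apply_div x hx := by
    rw [Pi.sub_apply, Pi.sub_apply, hE.apply_div x hx, hF.apply_div x hx]
    ring

theorem const_mul (K : ℂ) (hE : IsOddTheta q a r E) : IsOddTheta q a r fun x => K * E x where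
  analyticOnNhd := analyticOnNhd_const.mul hE.analyticOnNhd
  apply_q_mul x hx := by rw [mul_left_comm, hE.apply_q_mul x hx]
  apply_div x hx := by rw [hE.apply_div x hx, mul_neg]

theorem thetaFactor_pow_mul (hE : IsOddTheta q a r E) (hq0 : q ≠ 0) (ha : a ≠ 0) (n : ℤ) {x : ℂ}
    (hx : x ≠ 0) : thetaFactor q a n x ^ r * E (q ^ n * x) = E x := by
  have hstep : Function.Periodic (fun n => thetaFactor q a n x ^ r * E (q ^ n * x)) 1 := fun n => by
    have hqn := mul_ne_zero (zpow_ne_zero n hq0) hx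
    simp only [add_comm n 1, thetaFactor_add hq0 ha 1 n hx, zpow_one_add₀ hq0, mul_assoc q]
    rw [← hE.apply_q_mul _ hqn, mul_pow]
    simp only [thetaFactor, one_pow, zpow_one]
    ring
  simpa [thetaFactor] using hstep.int_mul_eq n

theorem eq_zero_of_eq_zpow_mul (hE : IsOddTheta q a r E) (hq0 : q ≠ 0) (ha : a ≠ 0) {x y : ℂ}
    (hy : y ≠ 0) (hEy : E y = 0) {n : ℤ} (hxy : x = q ^ n * y) : E x = 0 := by
  have h := hE.thetaFactor_pow_mul hq0 ha n hy
  rw [hEy, ← hxy] at h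
  exact (mul_eq_zero.1 h).resolve_left (pow_ne_zero r (thetaFactor_ne_zero hq0 ha n hy))

theorem eq_zero_of_sq_div_eq_zpow (hE : IsOddTheta q a r E) (hq0 : q ≠ 0) (ha : a ≠ 0) {x : ℂ}
    (hx : x ≠ 0) {n : ℤ} (h : x ^ 2 / a = q ^ n) : E x = 0 := by
  have hfactor : thetaFactor q a n (a / x) = 1 := by
    rw [← thetaFactor_neg ha n hx, thetaFactor, h, ← zpow_mul, ← zpow_add₀ hq0]
    ring_nf
    exact zpow_zero q
  have hqx : q ^ n * (a / x) = x := by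
    rw [← h]
    field_simp
  have hself := hE.thetaFactor_pow_mul hq0 ha n (div_ne_zero ha hx)
  rw [hfactor, one_pow, one_mul, hqx, hE.apply_div x hx] at hself
  linear_combination hself / 2

end IsOddTheta

/-- The odd theta function of degree `3` whose zeros are, modulo `q ^ ℤ`, the points `w`, `a / w`
and the solutions of `x ^ 2 = a` and `x ^ 2 = a * q`. -/
def oddThetaCubic (q a w x : ℂ) : ℂ :=
  x⁻¹ * (thetaProd q (x ^ 2 / a) * (thetaProd q (x * w / a) * thetaProd q (w / x)))

theorem isOddTheta_oddThetaCubic (hq0 : q ≠ 0) (hq : ‖q‖ < 1) (ha : a ≠ 0) (hw : w ≠ 0) :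
    IsOddTheta q a 3 (oddThetaCubic q a w) where
  analyticOnNhd x (hx : x ≠ 0) := by
    have hθ {f : ℂ → ℂ} (hf : AnalyticAt ℂ f x) (hfx : f x ≠ 0) :
        AnalyticAt ℂ (fun y => thetaProd q (f y)) x :=
      (analyticAt_thetaProd hq hfx).comp hf
    exact (analyticAt_inv hx).mul ((hθ (by fun_prop (disch := assumption)) (by positivity)).mul
      ((hθ (by fun_prop (disch := assumption)) (by positivity)).mul
        (hθ (by fun_prop (disch := assumption)) (by positivity))))
  apply_q_mul x hx := by
    have hsq : thetaProd q (x ^ 2 / a)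
        = q * (x ^ 2 / a) ^ 2 * thetaProd q ((q * x) ^ 2 / a) := by
      rw [← neg_mul_thetaProd_q_mul hq0 hq (by positivity),
        ← neg_mul_thetaProd_q_mul hq0 hq (by positivity),
        show q * (q * (x ^ 2 / a)) = (q * x) ^ 2 / a by ring]
      ring
    have hmul : thetaProd q (x * w / a) = -(x * w / a) * thetaProd q (q * x * w / a) := by
      rw [← neg_mul_thetaProd_q_mul hq0 hq (by positivity),
        show q * (x * w / a) = q * x * w / a by ring]
    have hdiv : thetaProd q (w / (q * x)) = -(w / (q * x)) * thetaProd q (w / x) := by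
      rw [← neg_mul_thetaProd_q_mul hq0 hq (by positivity),
        show q * (w / (q * x)) = w / x by field_simp]
    rw [oddThetaCubic, oddThetaCubic, hsq, hmul, hdiv]
    field_simp
  apply_div x hx := by
    have hsq : thetaProd q (x ^ 2 / a) = -(x ^ 2 / a) * thetaProd q ((a / x) ^ 2 / a) := by
      rw [← neg_mul_thetaProd_inv hq0 hq (by positivity),
        show (x ^ 2 / a)⁻¹ = (a / x) ^ 2 / a by field_simp]
    have hmul : a / x * w / a = w / x := by field_simp
    have hdiv : w / (a / x) = x * w / a := by field_simp
    rw [oddThetaCubic, oddThetaCubic, hsq, hmul, hdiv]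
    field_simp

theorem oddThetaCubic_self (hq : ‖q‖ < 1) (hw : w ≠ 0) : oddThetaCubic q a w w = 0 := by
  rw [oddThetaCubic, div_self hw, thetaProd_one hq, mul_zero, mul_zero, mul_zero]

theorem thetaProd_ne_zero_or_of_zpow_mul_zpow_eq (hq0 : q ≠ 0) (hq : ‖q‖ < 1) {t u v : ℂ}
    (ht : ∀ m : ℤ, t ≠ q ^ m) (hu : u ≠ 0) (hv : v ≠ 0) (i j : ℤ) (h : u ^ i * v ^ j = t) :
    thetaProd q u ≠ 0 ∨ thetaProd q v ≠ 0 := by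
  by_contra! h0
  obtain ⟨m, rfl⟩ := exists_eq_zpow_of_thetaProd_eq_zero hq0 hq hu h0.1
  obtain ⟨n, rfl⟩ := exists_eq_zpow_of_thetaProd_eq_zero hq0 hq hv h0.2
  refine ht (m * i + n * j) ?_
  rw [← h, zpow_add₀ hq0, zpow_mul, zpow_mul]

theorem analyticOrderAt_oddThetaCubic_le_one (hq0 : q ≠ 0) (hq : ‖q‖ < 1) (ha : a ≠ 0)
    (hw : w ≠ 0) (hwa : ∀ m : ℤ, w ^ 2 / a ≠ q ^ m) {x : ℂ} (hx : x ≠ 0) :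
    analyticOrderAt (oddThetaCubic q a w) x ≤ 1 := by
  have hsq0 : x ^ 2 / a ≠ 0 := by positivity
  have hmul0 : x * w / a ≠ 0 := by positivity
  have hdiv0 : w / x ≠ 0 := by positivity
  have hsq_mul : thetaProd q (x ^ 2 / a) ≠ 0 ∨ thetaProd q (x * w / a) ≠ 0 :=
    thetaProd_ne_zero_or_of_zpow_mul_zpow_eq hq0 hq hwa hsq0 hmul0 (-1) 2 (by field_simp)
  have hsq_div : thetaProd q (x ^ 2 / a) ≠ 0 ∨ thetaProd q (w / x) ≠ 0 :=
    thetaProd_ne_zero_or_of_zpow_mul_zpow_eq hq0 hq hwa hsq0 hdiv0 1 2 (by field_simp)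
  have hmul_div : thetaProd q (x * w / a) ≠ 0 ∨ thetaProd q (w / x) ≠ 0 :=
    thetaProd_ne_zero_or_of_zpow_mul_zpow_eq hq0 hq hwa hmul0 hdiv0 1 1 (by field_simp)
  have hθ {f : ℂ → ℂ} (hf : AnalyticAt ℂ f x) (hfx : f x ≠ 0) :
      AnalyticAt ℂ (thetaProd q ∘ f) x := (analyticAt_thetaProd hq hfx).comp hf
  have hsq : AnalyticAt ℂ (fun y => y ^ 2 / a) x := by fun_prop (disch := assumption)
  have hmul : AnalyticAt ℂ (fun y => y * w / a) x := by fun_prop (disch := assumption)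
  have hdiv : AnalyticAt ℂ (fun y => w / y) x := by fun_prop (disch := assumption)
  have hsq_order := analyticOrderAt_thetaProd_comp_le_one hq0 hq hsq (by simp [hx, ha]) hsq0
  have hmul_order := analyticOrderAt_thetaProd_comp_le_one hq0 hq hmul (by simp [hw, ha]) hmul0
  have hdiv_order := analyticOrderAt_thetaProd_comp_le_one hq0 hq hdiv
    (by simp [div_eq_mul_inv, hw, hx]) hdiv0
  have hinv_order : analyticOrderAt (fun y : ℂ => y⁻¹) x ≤ 1 :=
    ((analyticAt_inv hx).analyticOrderAt_eq_zero.2 (inv_ne_zero hx)).trans_le zero_le_one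
  refine analyticOrderAt_mul_le_one (analyticAt_inv hx)
    ((hθ hsq hsq0).mul ((hθ hmul hmul0).mul (hθ hdiv hdiv0))) hinv_order
    (analyticOrderAt_mul_le_one (hθ hsq hsq0) ((hθ hmul hmul0).mul (hθ hdiv hdiv0)) hsq_order
      (analyticOrderAt_mul_le_one (hθ hmul hmul0) (hθ hdiv hdiv0) hmul_order hdiv_order hmul_div)
      ?_) (Or.inl (inv_ne_zero hx))
  rw [mul_ne_zero_iff, or_and_left]
  exact ⟨hsq_mul, hsq_div⟩

theorem IsOddTheta.exists_eq_const_mul_oddThetaCubic (hE : IsOddTheta q a 3 E) (hq0 : q ≠ 0)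
    (hq : ‖q‖ < 1) (ha : a ≠ 0) (hw : w ≠ 0) (hwa : ∀ m : ℤ, w ^ 2 / a ≠ q ^ m)
    (hEw : E w = 0) : ∃ K : ℂ, ∀ x ≠ 0, E x = K * oddThetaCubic q a w x := by
  have hT := isOddTheta_oddThetaCubic hq0 hq ha hw
  have horder {x : ℂ} (hx : x ≠ 0) := analyticOrderAt_oddThetaCubic_le_one hq0 hq ha hw hwa hx
  refine exists_eq_const_mul_of_q_multiplier hq0 hq hE.analyticOnNhd hT.analyticOnNhd
    (fun x hx => ((horder hx).trans_lt ENat.one_lt_top).ne)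
    (fun x hx => analyticOrderAt_le_of_le_one (hE.analyticOnNhd x hx) (horder hx) fun h0 => ?_)
    hE.apply_q_mul hT.apply_q_mul
  rcases mul_eq_zero.1 ((mul_eq_zero.1 h0).resolve_left (inv_ne_zero hx)) with h | h
  · obtain ⟨n, hn⟩ := exists_eq_zpow_of_thetaProd_eq_zero hq0 hq (by positivity) h
    exact hE.eq_zero_of_sq_div_eq_zpow hq0 ha hx hn
  rcases mul_eq_zero.1 h with h | h
  · obtain ⟨n, hn⟩ := exists_eq_zpow_of_thetaProd_eq_zero hq0 hq (by positivity) h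
    have hEaw : E (a / w) = 0 := by rw [hE.apply_div w hw, hEw, neg_zero]
    refine hE.eq_zero_of_eq_zpow_mul hq0 ha (div_ne_zero ha hw) hEaw (n := n) ?_
    rw [← hn]
    field_simp
  · obtain ⟨n, hn⟩ := exists_eq_zpow_of_thetaProd_eq_zero hq0 hq (by positivity) h
    refine hE.eq_zero_of_eq_zpow_mul hq0 ha hw hEw (n := -n) ?_
    rw [zpow_neg, ← hn]
    field_simp

end OddTheta

section Interpolation

variable {q a y z : ℂ}

/-- Two-point interpolation: multiplied by `θ(x² / a) / x` this is the odd theta function of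
degree `3` that agrees with `E` at `y` and `z`. -/
def oddThetaInterp (q a y z : ℂ) (E : ℂ → ℂ) (x : ℂ) : ℂ :=
  thetaProd q (x * z / a) * thetaProd q (z / x) / (thetaProd q (y * z / a) * thetaProd q (z / y))
      * (y * E y / thetaProd q (y ^ 2 / a))
    + thetaProd q (x * y / a) * thetaProd q (y / x)
        / (thetaProd q (z * y / a) * thetaProd q (y / z))
      * (z * E z / thetaProd q (z ^ 2 / a))

theorem IsOddTheta.mul_eq_thetaProd_mul_oddThetaInterp {E : ℂ → ℂ} (hE : IsOddTheta q a 3 E)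
    (hq0 : q ≠ 0) (hq : ‖q‖ < 1) (ha : a ≠ 0) (hy : y ≠ 0) (hz : z ≠ 0)
    (hya : ∀ m : ℤ, y ^ 2 / a ≠ q ^ m) (hza : ∀ m : ℤ, z ^ 2 / a ≠ q ^ m)
    (hyza : ∀ m : ℤ, y * z / a ≠ q ^ m) (hzy : ∀ m : ℤ, z / y ≠ q ^ m) {x : ℂ} (hx : x ≠ 0) :
    x * E x = thetaProd q (x ^ 2 / a) * oddThetaInterp q a y z E x := by
  have hθya := thetaProd_ne_zero hq0 hq (by positivity) hya
  have hθza := thetaProd_ne_zero hq0 hq (by positivity) hza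
  have hθyza := thetaProd_ne_zero hq0 hq (by positivity) hyza
  have hθzy := thetaProd_ne_zero hq0 hq (by positivity) hzy
  have hθyz : thetaProd q (y / z) ≠ 0 := by
    rw [← inv_div] at hθzy
    rw [← neg_mul_thetaProd_inv hq0 hq (by positivity)]
    exact mul_ne_zero (neg_ne_zero.2 (by positivity)) hθzy
  have hθzya : thetaProd q (z * y / a) ≠ 0 := by rwa [mul_comm z]
  have hTz : oddThetaCubic q a z y ≠ 0 := by unfold oddThetaCubic; positivity
  have hTy : oddThetaCubic q a y z ≠ 0 := by unfold oddThetaCubic; positivity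
  obtain ⟨K, hK⟩ := (hE.sub ((isOddTheta_oddThetaCubic hq0 hq ha hz).const_mul
    (E y / oddThetaCubic q a z y))).exists_eq_const_mul_oddThetaCubic hq0 hq ha hy hya
    (by rw [Pi.sub_apply, div_mul_cancel₀ _ hTz, sub_self])
  have hKz := hK z hz
  rw [Pi.sub_apply, oddThetaCubic_self hq hz, mul_zero, sub_zero] at hKz
  have hEx := hK x hx
  rw [Pi.sub_apply, eq_div_of_mul_eq hTy hKz.symm, sub_eq_iff_eq_add] at hEx
  rw [hEx, oddThetaInterp]
  simp only [oddThetaCubic] at hTy hTz ⊢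
  field_simp
  ring

theorem continuousAt_oddThetaInterp {X : Type*} [TopologicalSpace X] {F : X → ℂ → ℂ} {v : X → ℂ}
    {t : X} (hq : ‖q‖ < 1) (ha : a ≠ 0) (hy : y ≠ 0) (hz : z ≠ 0)
    (hFy : ContinuousAt (fun s => F s y) t) (hFz : ContinuousAt (fun s => F s z) t)
    (hv : ContinuousAt v t) (hvt : v t ≠ 0) :
    ContinuousAt (fun s => oddThetaInterp q a y z (F s) (v s)) t := by
  have hθ {f : X → ℂ} (hf : ContinuousAt f t) (hft : f t ≠ 0) :
      ContinuousAt (fun s => thetaProd q (f s)) t :=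
    ContinuousAt.comp' (analyticAt_thetaProd hq hft).continuousAt hf
  have hmul {u : ℂ} (hu : u ≠ 0) : ContinuousAt (fun s => thetaProd q (v s * u / a)) t :=
    hθ ((hv.mul_const u).div_const a) (by positivity)
  have hdiv {u : ℂ} (hu : u ≠ 0) : ContinuousAt (fun s => thetaProd q (u / v s)) t :=
    hθ (continuousAt_const.div hv hvt) (by positivity)
  exact ((((hmul hz).mul (hdiv hz)).div_const _).mul ((hFy.const_mul y).div_const _)).add
    ((((hmul hy).mul (hdiv hy)).div_const _).mul ((hFz.const_mul z).div_const _))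

end Interpolation

section Terminating

variable {ι : Type*} [Fintype ι] {q a y z : ℂ} {r : ℕ} {p : ι → ℂ}

theorem wpTerm_apply_param_of_neg (hq0 : q ≠ 0) (hq : ‖q‖ < 1) (hp : ∀ i, p i ≠ 0) (i : ι) {n : ℤ}
    (hn : n < 0) : wpTerm q a r p n (p i) = 0 := by
  have hzero : qInf q (q ^ n * p i * q / p i) = 0 := by
    refine (qInf_eq_zero_iff hq).2 ⟨(-n - 1).toNat, ?_⟩
    rw [mul_right_comm, mul_div_cancel_right₀ _ (hp i), ← zpow_add_one₀ hq0, ← zpow_natCast,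
      ← zpow_add₀ hq0, Int.toNat_of_nonneg (by omega)]
    ring_nf
    exact zpow_zero q
  rw [wpTerm, wpKernel, omegaProd, Finset.prod_eq_zero (Finset.mem_univ i) hzero]
  ring

theorem wpSum_apply_param (hq0 : q ≠ 0) (hq : ‖q‖ < 1) (ha : a ≠ 0) (hp : ∀ i, p i ≠ 0)
    (hr : Fintype.card ι = 2 * r) (hw : ‖wpArg q a r p‖ < 1) (i : ι) :
    wpSum q a r p (p i) = wpHalfSum q a r p (p i) := by
  refine HasSum.tsum_eq ((Nat.cast_injective.hasSum_iff fun n hn => ?_).1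
    (hasSum_wpTerm_natCast hq0 hq ha hp hr hw (hp i)))
  refine wpTerm_apply_param_of_neg hq0 hq hp i (lt_of_not_ge fun h => hn ?_)
  exact ⟨n.toNat, Int.toNat_of_nonneg h⟩

theorem continuousAt_qInf_mul_oddThetaInterp_wpSum (hq0 : q ≠ 0) (hq : ‖q‖ < 1) (ha : a ≠ 0)
    (hp : ∀ i, p i ≠ 0) (hr : Fintype.card ι = 2 * r) (hw : ‖wpArg q a r p‖ < 1)
    (hy : y ≠ 0) (hz : z ≠ 0) (i : ι) :
    ContinuousAt (fun p' : ι → ℂ => qInf q (p' i ^ 2 / a)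
      * oddThetaInterp q a y z (wpSum q a r p') (p' i)) p := by
  have hcoord : ContinuousAt (fun p' : ι → ℂ => p' i) p := (continuous_apply i).continuousAt
  have hwpSum {x : ℂ} (hx : x ≠ 0) : ContinuousAt (fun p' : ι → ℂ => wpSum q a r p' x) p :=
    continuousAt_wpSum hq0 hq ha continuousAt_id hp hr hw hx
  exact ((continuous_qInf hq).continuousAt.comp' ((hcoord.pow 2).div_const a)).mul
    (continuousAt_oddThetaInterp hq ha hy hz (hwpSum hy) (hwpSum hz) hcoord (hp i))

variable [DecidableEq ι]

theorem prod_erase_mul_uniSum_of_ne_zero (hq0 : q ≠ 0) (hq : ‖q‖ < 1) (ha : a ≠ 0)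
    (hp : ∀ i, p i ≠ 0) (hr : Fintype.card ι = 2 * 3) (hw : ‖wpArg q a 3 p‖ < 1)
    (hy : y ≠ 0) (hz : z ≠ 0)
    (hya : ∀ m : ℤ, y ^ 2 / a ≠ q ^ m) (hza : ∀ m : ℤ, z ^ 2 / a ≠ q ^ m)
    (hyza : ∀ m : ℤ, y * z / a ≠ q ^ m) (hzy : ∀ m : ℤ, z / y ≠ q ^ m) (i : ι)
    (hi : thetaProd q (p i ^ 2 / a) ≠ 0) :
    (∏ j ∈ Finset.univ.erase i, qInf q (a * q / p i / p j)) * uniSum q a p (wpArg q a 3 p) (p i)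
      = qInf q (p i ^ 2 / a) * oddThetaInterp q a y z (wpSum q a 3 p) (p i) := by
  have hpi := hp i
  have hinterp := (isOddTheta_wpSum hq0 hq ha hp hr hw).mul_eq_thetaProd_mul_oddThetaInterp
    hq0 hq ha hy hz hya hza hyza hzy hpi
  have hq_div : q / (p i ^ 2 / a) = a * q / p i / p i := by field_simp
  rw [thetaProd, hq_div] at hinterp hi
  rw [wpSum_apply_param hq0 hq ha hp hr hw i, wpHalfSum, mul_inv_cancel_left₀ hpi, omegaProd,
    ← Finset.mul_prod_erase _ _ (Finset.mem_univ i)] at hinterp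
  refine mul_left_cancel₀ (right_ne_zero_of_mul hi) ?_
  linear_combination hinterp

theorem continuousAt_prod_erase_mul_uniSum (hq0 : q ≠ 0) (hq : ‖q‖ < 1) (hp : ∀ i, p i ≠ 0)
    (hw : ‖wpArg q a r p‖ < 1) (i : ι) :
    ContinuousAt (fun p' : ι → ℂ => (∏ j ∈ Finset.univ.erase i, qInf q (a * q / p' i / p' j))
      * uniSum q a p' (wpArg q a r p') (p' i)) p := by
  have hcoord (j : ι) : ContinuousAt (fun p' : ι → ℂ => p' j) p := (continuous_apply j).continuousAt
  refine ContinuousAt.mul (tendsto_finsetProd _ fun j _ => ?_) (continuousAt_uniSum hq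
    continuousAt_id hp (continuousAt_wpArg hq0 continuousAt_id hp) hw (hcoord i))
  exact (continuous_qInf hq).continuousAt.comp'
    ((continuousAt_const.div (hcoord i) (hp i)).div (hcoord j) (hp j))

/- The case `θ(pᵢ² / a) = 0` follows by varying `pᵢ`. -/
theorem prod_erase_mul_uniSum (hq0 : q ≠ 0) (hq : ‖q‖ < 1) (ha : a ≠ 0)
    (hp : ∀ i, p i ≠ 0) (hr : Fintype.card ι = 2 * 3) (hw : ‖wpArg q a 3 p‖ < 1)
    (hy : y ≠ 0) (hz : z ≠ 0)
    (hya : ∀ m : ℤ, y ^ 2 / a ≠ q ^ m) (hza : ∀ m : ℤ, z ^ 2 / a ≠ q ^ m)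
    (hyza : ∀ m : ℤ, y * z / a ≠ q ^ m) (hzy : ∀ m : ℤ, z / y ≠ q ^ m) (i : ι) :
    (∏ j ∈ Finset.univ.erase i, qInf q (a * q / p i / p j)) * uniSum q a p (wpArg q a 3 p) (p i)
      = qInf q (p i ^ 2 / a) * oddThetaInterp q a y z (wpSum q a 3 p) (p i) := by
  have hpi := hp i
  have hupdate : Tendsto (Function.update p i) (𝓝[≠] p i) (𝓝 p) := by
    have hcont : ContinuousAt (Function.update p i) (p i) := by fun_prop
    simpa only [Function.update_eq_self] using hcont.tendsto.mono_left nhdsWithin_le_nhds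
  have hsq : AnalyticAt ℂ (fun t => t ^ 2 / a) (p i) := by fun_prop (disch := assumption)
  have hsq0 : p i ^ 2 / a ≠ 0 := by positivity
  have horder := analyticOrderAt_thetaProd_comp_le_one hq0 hq hsq (by simp [hpi, ha]) hsq0
  have hθ : ∀ᶠ t in 𝓝[≠] p i, thetaProd q (t ^ 2 / a) ≠ 0 :=
    eventually_ne_zero_of_analyticOrderAt_ne_top
      ((analyticAt_thetaProd hq hsq0).comp (f := fun t => t ^ 2 / a) hsq)
      (horder.trans_lt ENat.one_lt_top).ne
  refine tendsto_nhds_unique_of_eventuallyEq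
    ((continuousAt_prod_erase_mul_uniSum hq0 hq hp hw i).tendsto.comp hupdate)
    ((continuousAt_qInf_mul_oddThetaInterp_wpSum hq0 hq ha hp hr hw hy hz i).tendsto.comp hupdate)
    ?_
  filter_upwards [hupdate.eventually (eventually_ne_zero_and_norm_wpArg_lt_one hq0 hp hw), hθ]
    with t ⟨ht, hwt⟩ hθt
  exact prod_erase_mul_uniSum_of_ne_zero hq0 hq ha ht hr hwt hy hz hya hza hyza hzy i
    (by rwa [Function.update_self])

end Terminating

section ThreeTermRelation

variable {q a y z : ℂ}

theorem Omega_ofFn (xs : List ℂ) {N : ℕ} (p : Fin N → ℂ) :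
    Omega q xs (List.ofFn p) = (xs.map (omegaProd q p)).prod := by
  simp only [Omega, List.map_ofFn, List.prod_ofFn, Function.comp_def]
  rfl

theorem Omega_sextuple (xs : List ℂ) (p : Fin 6 → ℂ) :
    Omega q xs [p 0, p 1, p 2, p 3, p 4, p 5] = (xs.map (omegaProd q p)).prod := by
  rw [← Omega_ofFn]
  rfl

theorem thetaL_pair_div_thetaL_pair (hq0 : q ≠ 0) (hq : ‖q‖ < 1) {s t u v : ℂ} (hs : s ≠ 0)
    (ht : t ≠ 0) (hu : u ≠ 0) (hv : v ≠ 0) :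
    thetaL q [s, t] / thetaL q [u, v]
      = thetaProd q s * thetaProd q t / (thetaProd q u * thetaProd q v) := by
  obtain ⟨K, hK0, hK⟩ := exists_theta_eq_const_mul_thetaProd hq0 hq
  simp only [thetaL, List.map_cons, List.map_nil, List.prod_cons, List.prod_nil, mul_one,
    hK s hs, hK t ht, hK u hu, hK v hv]
  rw [mul_mul_mul_comm K _ K, mul_mul_mul_comm K _ K, mul_div_mul_left _ _ (mul_ne_zero hK0 hK0)]

theorem qInf_sq_div (hq : ‖q‖ < 1) (x : ℂ) :
    qInf q (x ^ 2 / a) = (1 - x ^ 2 / a) * qInf q (x ^ 2 * q / a) := by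
  rw [qInf_eq_one_sub_mul hq, mul_div_assoc', mul_comm q]

theorem thetaProd_sq_div (hq : ‖q‖ < 1) (x : ℂ) :
    thetaProd q (x ^ 2 / a)
      = (1 - x ^ 2 / a) * (qInf q (x ^ 2 * q / a) * qInf q (a * q / x ^ 2)) := by
  rw [thetaProd, qInf_sq_div hq, div_div_eq_mul_div, mul_comm q a, mul_assoc]

theorem omegaProd_div_mul_vwpPsi (hq0 : q ≠ 0) (hq : ‖q‖ < 1) (ha : a ≠ 0) {N r : ℕ}
    {p : Fin N → ℂ} (hp : ∀ i, p i ≠ 0) (hr : N = 2 * r) (hw : ‖wpArg q a r p‖ < 1) {x : ℂ}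
    (hx : x ≠ 0) (hxa : ∀ m : ℤ, x ^ 2 / a ≠ q ^ m) (hΩ : omegaProd q p (x * q) ≠ 0)
    (hΩ' : omegaProd q p (a * q / x) ≠ 0) :
    omegaProd q p (a * q / x) * omegaProd q p (x * q)
        / (qInf q (x ^ 2 * q / a) * qInf q (a * q / x ^ 2))
        * vwpPsi q (x ^ 2 / a) (List.ofFn fun i => p i * x / a) (wpArg q a r p)
      = x * wpSum q a r p x / thetaProd q (x ^ 2 / a) := by
  rw [vwpPsi, (hasSum_vwpPsiTerm hq0 hq ha hp hr hw hx hxa hΩ hΩ').tsum_eq, thetaProd_sq_div hq]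
  generalize omegaProd q p (x * q) = Ω, omegaProd q p (a * q / x) = Ω' at hΩ hΩ'
  field_simp

theorem qInf_self_mul_Omega_tail {N : ℕ} {p : Fin (N + 1) → ℂ} (hp : p 0 ≠ 0) :
    qInf q q * Omega q [a * q / p 0, p 0 * q] (List.ofFn fun i : Fin N => p i.succ)
      = (∏ j ∈ Finset.univ.erase 0, qInf q (a * q / p 0 / p j)) * omegaProd q p (p 0 * q) := by
  have hcancel : p 0 * q / p 0 = q := mul_div_cancel_left₀ q hp
  rw [omegaProd, Fin.prod_univ_succ, hcancel, Fin.univ_succ, Finset.erase_cons, Finset.prod_map,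
    Omega_ofFn, mul_left_comm]
  simp only [List.map_cons, List.map_nil, List.prod_cons, List.prod_nil, mul_one]
  rfl

/-- The factor shared by the two coefficients `λ₁ = lambda₁` and `μ₁ = mu₁` for the parameters
`b, c, … = p 0, p 1, …`. -/
def connectionFactor (q a : ℂ) {N : ℕ} (p : Fin (N + 1) → ℂ) : ℂ :=
  qInf q (p 0 ^ 2 * q / a)
    / (qInf q q * Omega q [a * q / p 0, p 0 * q] (List.ofFn fun i : Fin N => p i.succ))

theorem connectionFactor_sextuple (p : Fin 6 → ℂ) :
    connectionFactor q a p = qInf q (p 0 ^ 2 * q / a)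
      / (qInf q q * Omega q [a * q / p 0, p 0 * q] [p 1, p 2, p 3, p 4, p 5]) :=
  rfl

theorem W_eq_connectionFactor_mul_oddThetaInterp (hq0 : q ≠ 0) (hq : ‖q‖ < 1) (ha : a ≠ 0)
    {p : Fin 6 → ℂ} (hp : ∀ i, p i ≠ 0) (hw : ‖wpArg q a 3 p‖ < 1) (hy : y ≠ 0) (hz : z ≠ 0)
    (hya : ∀ m : ℤ, y ^ 2 / a ≠ q ^ m) (hza : ∀ m : ℤ, z ^ 2 / a ≠ q ^ m)
    (hyza : ∀ m : ℤ, y * z / a ≠ q ^ m) (hzy : ∀ m : ℤ, z / y ≠ q ^ m)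
    (hA : ∀ n : ℕ, p 0 ^ 2 / a * q ^ (2 * n) ≠ 1)
    (hΩ : Omega q [a * q / p 0, p 0 * q] (List.ofFn fun i : Fin 5 => p i.succ) ≠ 0) :
    W q (p 0 ^ 2 / a) (List.ofFn fun i : Fin 5 => p 0 * p i.succ / a) (wpArg q a 3 p)
      = connectionFactor q a p * oddThetaInterp q a y z (wpSum q a 3 p) (p 0) := by
  have hsplit := qInf_self_mul_Omega_tail (q := q) (a := a) (hp 0)
  have hprod := hsplit ▸ mul_ne_zero (qInf_self_ne_zero hq) hΩ
  have hA0 : 1 - p 0 ^ 2 / a ≠ 0 := sub_ne_zero.2 (by simpa using (hA 0).symm)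
  have hsum := prod_erase_mul_uniSum hq0 hq ha hp (by simp) hw hy hz hya hza hyza hzy 0
  rw [qInf_sq_div hq] at hsum
  rw [W, (hasSum_WTerm hq0 hq ha hp hw hA (right_ne_zero_of_mul hprod)).tsum_eq,
    connectionFactor, hsplit, div_mul_eq_mul_div,
    div_eq_div_iff (mul_ne_zero hA0 (right_ne_zero_of_mul hprod)) hprod]
  linear_combination omegaProd q p (p 0 * q) * hsum

theorem lambda₁_mul_vwpPsi (hq0 : q ≠ 0) (hq : ‖q‖ < 1) (ha : a ≠ 0) (hz : z ≠ 0)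
    {p : Fin 6 → ℂ} (hp : ∀ i, p i ≠ 0) (hw : ‖wpArg q a 3 p‖ < 1) (haq : ∀ m : ℤ, a ≠ q ^ m)
    (hΩ : omegaProd q p q ≠ 0) (hΩ' : omegaProd q p (a * q) ≠ 0) :
    lambda₁ q a (p 0) (p 1) (p 2) (p 3) (p 4) (p 5) z
        * vwpPsi q a (List.ofFn p) (wpArg q a 3 p)
      = connectionFactor q a p
        * (thetaProd q (p 0 * z / a) * thetaProd q (z / p 0)
            / (thetaProd q z * thetaProd q (z / a))
          * (a * wpSum q a 3 p a / thetaProd q a)) := by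
  have hp0 := hp 0
  have hcancel (u : ℂ) : u * a / a = u := mul_div_cancel_right₀ u ha
  have hsq : a ^ 2 / a = a := by rw [sq, hcancel]
  have hψ := omegaProd_div_mul_vwpPsi hq0 hq ha hp rfl hw ha (by rwa [hsq])
    hΩ' (by rwa [mul_div_cancel_left₀ _ ha])
  rw [hsq, mul_div_cancel_left₀ q ha, mul_div_right_comm (a ^ 2), hsq, sq a,
    mul_div_mul_left q a ha] at hψ
  simp only [hcancel] at hψ
  rw [← hψ, lambda₁, thetaL_pair_div_thetaL_pair hq0 hq (by positivity) (by positivity)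
    (by positivity) hz, connectionFactor_sextuple, Omega_sextuple]
  simp only [qInfL, List.map_cons, List.map_nil, List.prod_cons, List.prod_nil, mul_one]
  ring

theorem mu₁_mul_vwpPsi (hq0 : q ≠ 0) (hq : ‖q‖ < 1) (ha : a ≠ 0) (hz : z ≠ 0)
    {p : Fin 6 → ℂ} (hp : ∀ i, p i ≠ 0) (hw : ‖wpArg q a 3 p‖ < 1)
    (hza : ∀ m : ℤ, z ^ 2 / a ≠ q ^ m) (hΩ : omegaProd q p (z * q) ≠ 0)
    (hΩ' : omegaProd q p (a * q / z) ≠ 0) :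
    mu₁ q a (p 0) (p 1) (p 2) (p 3) (p 4) (p 5) z
        * vwpPsi q (z ^ 2 / a) (List.ofFn fun i => p i * z / a) (wpArg q a 3 p)
      = connectionFactor q a p
        * (thetaProd q (p 0) * thetaProd q (a / p 0) / (thetaProd q z * thetaProd q (a / z))
          * (z * wpSum q a 3 p z / thetaProd q (z ^ 2 / a))) := by
  have hp0 := hp 0
  rw [← omegaProd_div_mul_vwpPsi hq0 hq ha hp rfl hw hz hza hΩ hΩ', mu₁,
    thetaL_pair_div_thetaL_pair hq0 hq (by positivity) hp0 (by positivity) hz,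
    connectionFactor_sextuple, Omega_sextuple]
  simp only [qInfL, List.map_cons, List.map_nil, List.prod_cons, List.prod_nil, mul_one]
  ring

theorem W_eq_lambda₁_mul_vwpPsi_add_mu₁_mul_vwpPsi (hq0 : q ≠ 0) (hq : ‖q‖ < 1) (ha : a ≠ 0)
    (hz : z ≠ 0) {p : Fin 6 → ℂ} (hp : ∀ i, p i ≠ 0) (hw : ‖wpArg q a 3 p‖ < 1)
    (haq : ∀ m : ℤ, a ≠ q ^ m) (hza : ∀ m : ℤ, z ^ 2 / a ≠ q ^ m)
    (hzq : ∀ m : ℤ, z ≠ q ^ m ∧ z / a ≠ q ^ m)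
    (hA : ∀ n : ℕ, p 0 ^ 2 / a * q ^ (2 * n) ≠ 1)
    (hΩq : omegaProd q p q ≠ 0) (hΩaq : omegaProd q p (a * q) ≠ 0)
    (hΩaqz : omegaProd q p (a * q / z) ≠ 0) (hΩzq : omegaProd q p (z * q) ≠ 0)
    (hΩ : Omega q [a * q / p 0, p 0 * q] (List.ofFn fun i : Fin 5 => p i.succ) ≠ 0) :
    W q (p 0 ^ 2 / a) (List.ofFn fun i : Fin 5 => p 0 * p i.succ / a) (wpArg q a 3 p)
      = lambda₁ q a (p 0) (p 1) (p 2) (p 3) (p 4) (p 5) z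
          * vwpPsi q a (List.ofFn p) (wpArg q a 3 p)
        + mu₁ q a (p 0) (p 1) (p 2) (p 3) (p 4) (p 5) z
          * vwpPsi q (z ^ 2 / a) (List.ofFn fun i => p i * z / a) (wpArg q a 3 p) := by
  have hcancel (u : ℂ) : u * a / a = u := mul_div_cancel_right₀ u ha
  have hsq : a ^ 2 / a = a := by rw [sq, hcancel]
  have haz : a * z / a = z := mul_div_cancel_left₀ z ha
  rw [W_eq_connectionFactor_mul_oddThetaInterp hq0 hq ha hp hw ha hz (by rwa [hsq]) hza
      (by rw [haz]; exact fun m => (hzq m).1) (fun m => (hzq m).2) hA hΩ,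
    lambda₁_mul_vwpPsi hq0 hq ha hz hp hw haq hΩq hΩaq,
    mu₁_mul_vwpPsi hq0 hq ha hz hp hw hza hΩzq hΩaqz, ← mul_add, oddThetaInterp, hsq, haz,
    hcancel, hcancel]

theorem summable_vwpPsiTerm_self (hq0 : q ≠ 0) (hq : ‖q‖ < 1) (ha : a ≠ 0) {N r : ℕ}
    {p : Fin N → ℂ} (hp : ∀ i, p i ≠ 0) (hr : N = 2 * r) (hw : ‖wpArg q a r p‖ < 1)
    (haq : ∀ m : ℤ, a ≠ q ^ m) (hΩ : omegaProd q p q ≠ 0) (hΩ' : omegaProd q p (a * q) ≠ 0) :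
    Summable (vwpPsiTerm q a (List.ofFn p) (wpArg q a r p)) := by
  have hcancel (u : ℂ) : u * a / a = u := mul_div_cancel_right₀ u ha
  have hsq : a ^ 2 / a = a := by rw [sq, hcancel]
  have hsum := (hasSum_vwpPsiTerm hq0 hq ha hp hr hw ha (by rwa [hsq]) hΩ'
    (by rwa [mul_div_cancel_left₀ _ ha])).summable
  simpa only [hsq, hcancel] using hsum

theorem omegaProd_ne_zero_iff_forall_pow (hq : ‖q‖ < 1) {ι : Type*} [Fintype ι] {p : ι → ℂ}
    {x : ℂ} : omegaProd q p x ≠ 0 ↔ ∀ i, ∀ n : ℕ, x / p i * q ^ n ≠ 1 := by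
  simp only [omegaProd_ne_zero_iff, ne_eq, qInf_eq_zero_iff hq, not_exists]

theorem Omega_pair_ne_zero_iff (hq : ‖q‖ < 1) {N : ℕ} {p : Fin N → ℂ} {s t : ℂ} :
    Omega q [s, t] (List.ofFn p) ≠ 0
      ↔ ∀ i, ∀ n : ℕ, s / p i * q ^ n ≠ 1 ∧ t / p i * q ^ n ≠ 1 := by
  simp only [Omega_ofFn, List.map_cons, List.map_nil, List.prod_cons, List.prod_nil, mul_one,
    mul_ne_zero_iff, omegaProd_ne_zero_iff_forall_pow hq, forall_and]

theorem omegaProd_zero_mul_ne_zero (hq : ‖q‖ < 1) {N : ℕ} {p : Fin (N + 1) → ℂ} (hp : p 0 ≠ 0)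
    (hΩ : Omega q [a * q / p 0, p 0 * q] (List.ofFn fun i : Fin N => p i.succ) ≠ 0) :
    omegaProd q p (p 0 * q) ≠ 0 :=
  right_ne_zero_of_mul (qInf_self_mul_Omega_tail hp ▸ mul_ne_zero (qInf_self_ne_zero hq) hΩ)

end ThreeTermRelation

end

end QSeries

theorem mainTheorem4 (q a b c d e h k z : ℂ)
    (hq0 : 0 < ‖q‖) (hq1 : ‖q‖ < 1)
    (ha0 : a ≠ 0) (hz0 : z ≠ 0)
    (hne : ∀ x ∈ [b, c, d, e, h, k], x ≠ 0)
    (hconv : ‖a ^ 3 * q ^ 2 / (b * c * d * e * h * k)‖ < 1)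
    -- no denominator vanishes in `λ₁`, `μ₁` and the three series
    (ha : ∀ m : ℤ, a ≠ q ^ m)
    (hza : ∀ m : ℤ, z ^ 2 / a ≠ q ^ m)
    (hz : ∀ m : ℤ, z ≠ q ^ m ∧ z / a ≠ q ^ m)
    (hba : ∀ n : ℕ, b ^ 2 / a * q ^ (2 * n) ≠ 1)
    (hpsi : ∀ x ∈ [b, c, d, e, h, k], ∀ n : ℕ,
      q / x * q ^ n ≠ 1 ∧ a * q / x * q ^ n ≠ 1 ∧
      a * q / z / x * q ^ n ≠ 1 ∧ z * q / x * q ^ n ≠ 1)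
    (hW : ∀ x ∈ [c, d, e, h, k], ∀ n : ℕ,
      a * q / b / x * q ^ n ≠ 1 ∧ b * q / x * q ^ n ≠ 1) :
    Summable (QSeries.WTerm q (b ^ 2 / a)
      [b * c / a, b * d / a, b * e / a, b * h / a, b * k / a]
      (a ^ 3 * q ^ 2 / (b * c * d * e * h * k))) ∧
    Summable (QSeries.vwpPsiTerm q a [b, c, d, e, h, k]
      (a ^ 3 * q ^ 2 / (b * c * d * e * h * k))) ∧
    Summable (QSeries.vwpPsiTerm q (z ^ 2 / a)
      [b * z / a, c * z / a, d * z / a, e * z / a, h * z / a, k * z / a]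
      (a ^ 3 * q ^ 2 / (b * c * d * e * h * k))) ∧
    QSeries.W q (b ^ 2 / a)
        [b * c / a, b * d / a, b * e / a, b * h / a, b * k / a]
        (a ^ 3 * q ^ 2 / (b * c * d * e * h * k))
      = QSeries.lambda₁ q a b c d e h k z
          * QSeries.vwpPsi q a [b, c, d, e, h, k]
              (a ^ 3 * q ^ 2 / (b * c * d * e * h * k))
        + QSeries.mu₁ q a b c d e h k z
          * QSeries.vwpPsi q (z ^ 2 / a)
              [b * z / a, c * z / a, d * z / a, e * z / a, h * z / a, k * z / a]
              (a ^ 3 * q ^ 2 / (b * c * d * e * h * k)) := by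
  open QSeries in
  have hq : q ≠ 0 := norm_pos_iff.1 hq0
  let p : Fin 6 → ℂ := ![b, c, d, e, h, k]
  have hp : ∀ i, p i ≠ 0 := (List.forall_mem_ofFn_iff (f := p)).1 hne
  have hw : a ^ 3 * q ^ 2 / (b * c * d * e * h * k) = wpArg q a 3 p := by
    rw [wpArg, Fin.prod_univ_six, mul_pow, pow_succ' q 2, mul_left_comm, mul_div_mul_left _ _ hq]
    rfl
  have ⟨hΩq, hΩaq, hΩaqz, hΩzq⟩ : omegaProd q p q ≠ 0 ∧ omegaProd q p (a * q) ≠ 0 ∧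
      omegaProd q p (a * q / z) ≠ 0 ∧ omegaProd q p (z * q) ≠ 0 := by
    simpa only [omegaProd_ne_zero_iff_forall_pow hq1, ← forall_and] using
      (List.forall_mem_ofFn_iff (f := p)).1 hpsi
  have hΩ : Omega q [a * q / b, b * q] [c, d, e, h, k] ≠ 0 :=
    (Omega_pair_ne_zero_iff hq1).2 ((List.forall_mem_ofFn_iff (f := fun i => p i.succ)).1 hW)
  rw [hw] at hconv ⊢
  exact ⟨(hasSum_WTerm hq hq1 ha0 hp hconv hba (omegaProd_zero_mul_ne_zero hq1 (hp 0) hΩ)).summable,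
    summable_vwpPsiTerm_self (p := p) hq hq1 ha0 hp rfl hconv ha hΩq hΩaq,
    (hasSum_vwpPsiTerm hq hq1 ha0 hp rfl hconv hz0 hza hΩzq hΩaqz).summable,
    W_eq_lambda₁_mul_vwpPsi_add_mu₁_mul_vwpPsi (p := p) hq hq1 ha0 hz0 hp hconv ha hza hz hba
      hΩq hΩaq hΩaqz hΩzq hΩ⟩
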